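/- Let $n\ge 2$. There is a compact set $S\subseteq\mathbb{R}^n$ of Lebesgue measure zero that contains a point of Fréchet differentiability of every Lipschitz function $g\colon\mathbb{R}^n\to\mathbb{R}$. Such a set is given explicitly as follows. Let $(N_r)_{r\ge1}$ be a sequence of odd integers with $N_r>1$ for all $r$, $N_r\to\infty$ and $\sum_r 1/N_r^2=\infty$ (such sequences exist). Let $\mathfrak S$ be the set of real sequences $i=(i_r)_{r\ge1}$ with $1\le i_r<N_r$ for all $r$ and $i_r/N_r\to0$, and for $i,j\in\mathfrak S$ write $i\prec j$ if $i_r>j_r$ for all $r$ and $i_r/j_r\to\infty$. Put $d_0=1$, $d_r=1/(N_1\cdots N_r)$ and $C_r=d_{r-1}\bigl((\tfrac12,\tfrac12)+\mathbb{Z}^2\bigr)\subseteq\mathbb{R}^2$ for $r\ge1$. For $i\in\mathfrak S$ let $$W_i=\mathbb{R}^2\setminus\bigcup_{r\ge1}\bigcup_{c\in C_r}B_\infty\bigl(c,\tfrac12 i_r d_r\bigr),\qquad M_i=W_i\times\mathbb{R}^{n-2}\subseteq\mathbb{R}^n,$$ where $B_\infty(c,\rho)$ is the open ball of centre $c$ and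 radius $\rho$ in the supremum norm of $\mathbb{R}^2$, so that $B_\infty(c,\tfrac12 i_rd_r)$ is an open square of side $i_rd_r$. Then $\mathfrak S\ne\emptyset$, and for every $l\in\mathfrak S$ there is $k\in\mathfrak S$ with $k\prec l$. Moreover, for all $k,l\in\mathfrak S$ with $k\prec l$, the set $M_k$ is non-empty and, for every $y\in M_k$ and every real $d>0$, the set $S=M_l\cap\overline{B(y,d)}$, where $\overline{B(y,d)}$ is the closed Euclidean ball of centre $y$ and radius $d$, is compact, has Lebesgue measure zero and contains a point of Fréchet differentiability of every Lipschitz function $g\colon\mathbb{R}^n\to\mathbb{R}$. -/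

import Mathlib

open Filter Topology MeasureTheory

noncomputable section

namespace DifferentiabilitySet

/- Sequences indexed by the positive integers are represented as functions on `ℕ`,
with the value at `r` standing for the term of index `r + 1`. -/

/-- A sequence of odd integers greater than one that tends to infinity and whose inverse
squares have a divergent sum. -/
structure IsAdmissible (N : ℕ → ℕ) : Prop where
  odd : ∀ r, Odd (N r)
  one_lt : ∀ r, 1 < N r
  tendsto : Tendsto N atTop atTop
  not_summable : ¬ Summable fun r => 1 / (N r : ℝ) ^ 2

/-- The set of real sequences `i` with `1 ≤ i r < N r` for all `r` and `i r / N r → 0`. -/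
def indexSet (N : ℕ → ℕ) : Set (ℕ → ℝ) :=
  {i | (∀ r, 1 ≤ i r ∧ i r < N r) ∧ Tendsto (fun r => i r / N r) atTop (𝓝 0)}

/-- The strict order `i ≺ j` on index sequences: `i r > j r` for all `r`, and `i r / j r → ∞`. -/
def Prec (i j : ℕ → ℝ) : Prop :=
  (∀ r, j r < i r) ∧ Tendsto (fun r => i r / j r) atTop atTop

/-- The scales: `scale N r` is the inverse of the product of the first `r` terms of `N`, so that
`scale N 0 = 1`. -/
def scale (N : ℕ → ℕ) (r : ℕ) : ℝ :=
  1 / ∏ s ∈ Finset.range r, (N s : ℝ)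

/-- The lattice of planar points `scale N r • ((1/2, 1/2) + ℤ²)`. -/
def lattice (N : ℕ → ℕ) (r : ℕ) : Set (ℝ × ℝ) :=
  {c | ∃ a b : ℤ, c = (scale N r * (1 / 2 + a), scale N r * (1 / 2 + b))}

/-- The complement in the plane of all open squares with centre in `lattice N r` and side
`i r * scale N (r + 1)`. The product `ℝ × ℝ` carries the supremum metric, so `Metric.ball` is an
open square whose side is twice the radius. -/
def planarSet (N : ℕ → ℕ) (i : ℕ → ℝ) : Set (ℝ × ℝ) :=
  (⋃ r : ℕ, ⋃ c ∈ lattice N r, Metric.ball c (1 / 2 * i r * scale N (r + 1)))ᶜ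

/-- The product of `planarSet N i` with `ℝⁿ⁻²`, as a subset of Euclidean space `ℝⁿ`, `n ≥ 2`. -/
def cylinderSet {n : ℕ} (hn : 2 ≤ n) (N : ℕ → ℕ) (i : ℕ → ℝ) : Set (EuclideanSpace ℝ (Fin n)) :=
  {x | (x ⟨0, by omega⟩, x ⟨1, by omega⟩) ∈ planarSet N i}

/-- The set `S` contains a point of Fréchet differentiability of every Lipschitz function
`g : ℝⁿ → ℝ`. -/
def CapturesDifferentiability {n : ℕ} (S : Set (EuclideanSpace ℝ (Fin n))) : Prop :=
  ∀ g : EuclideanSpace ℝ (Fin n) → ℝ, (∃ K : NNReal, LipschitzWith K g) →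
    ∃ x ∈ S, DifferentiableAt ℝ g x

end DifferentiabilitySet

end

/-!
A point of differentiability is found by almost maximising a directional derivative over pairs of a
point and a unit direction.

Let `f` be a Lipschitz function on a Hilbert space, and suppose that at `x` its derivative in the
unit direction `e` exists but that `f` is not Fréchet differentiable at `x`. Then there are
arbitrarily small `v` for which `f (x + v)` deviates from its linear prediction by a fixed multiple
of `‖v‖`. Along the flat wedge with vertices `x - R • e`, `x + v`, `x + R • e`, where `‖v‖` is a
small multiple `κ * R` of `R`, the excess of the slope of `f` over the derivative at `x` has large
variation, while its total increment nearly vanishes. Hence the slope is larger than that derivative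
on a substantial part of the wedge. The gain is of first order in `κ`, while the length of the wedge
exceeds that of its base by a term of second order only, so some point `y` of the wedge has a
directional derivative exceeding that at `x` by a fixed amount. A weak type inequality for the
maximal difference quotient (`exists_deriv_ge_and_increment_le`) allows one to choose `y` so that,
moreover, the increments of `f` from `y` and from `x` in the direction `e` differ by at most a
constant times the square root of the gain (`exists_improved_direction`). The argument uses only
that segments near `x` can be approximated by segments in the set `M` in which `y` is sought, with
an error small compared to the distance scale (`ApproximableAt`).

On the other hand, the directional derivative can be almost maximised subject to such a control of
increments: along a sequence of almost maximal pairs, each satisfying the control with respect to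
all the preceding ones, the points, the directions and the derivatives converge, and the control
makes the limit of the derivatives a directional derivative at the limit point. The directions are
forced to converge by small linear perturbations of `f`. As improvement takes place in a set larger
than the one containing the given point, the maximisation runs over a chain of closed sets `M u`,
`0 ≤ u ≤ 1`, with decreasing upper bounds for the index `u`, and the limit point has an
index below one (`exists_almost_locally_maximal`). There the improvement contradicts
maximality unless `f` is differentiable (`exists_differentiableAt_of_approximable`).

For the sets in question the chain consists of the cylinders over the planar sets of the geometric
means `k ^ (1 - u) * l ^ u`, any two of which are comparable in the strict order
(`prec_interpolate`). Segments can be approximated (`approximableAt_planarSet`) because the squares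
of high order are sparse: for integers `p`, `q` of different parity, the form `q * y - p * x` takes
on the centres of the squares of order `r` only values that are odd multiples of `scale N r / 2`, so
that its level lines at integer multiples of `scale N m` miss all small squares of order at least
`m`. Only the squares of a single critical order require an adjustment of the line.

The cylinders are null sets (`volume_cylinderSet`): at each order at least the proportion `1 / N r ^ 2` of
the remaining area is removed, as the central one of `N r ^ 2` equal cells, since `N r` is odd, and
the sum of these proportions diverges.
-/

open scoped NNReal ENNReal

namespace DifferentiabilitySet

/-! ### Increments and derivatives of Lipschitz functions on the line -/

theorem abs_sub_le_lintegral_deriv {h : ℝ → ℝ} {Λ : ℝ≥0} (hh : LipschitzWith Λ h) (u v : ℝ) :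
    ENNReal.ofReal |h v - h u| ≤ ∫⁻ x in Set.uIcc u v, ‖deriv h x‖ₑ := by
  have h1 := (hh.lipschitzOnWith (s := Set.uIcc u v)).absolutelyContinuousOnInterval
    |>.integral_deriv_eq_sub
  rw [← h1, ← Real.norm_eq_abs, ofReal_norm,
    intervalIntegral.intervalIntegral_eq_integral_uIoc]
  have h2 : ‖(if u ≤ v then (1 : ℝ) else -1) • ∫ x in Set.uIoc u v, deriv h x‖ₑ
      = ‖∫ x in Set.uIoc u v, deriv h x‖ₑ := by
    split_ifs <;> simp
  rw [h2]
  exact (enorm_integral_le_lintegral_enorm _).trans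
    (lintegral_mono_set Set.uIoc_subset_uIcc)

/-- Weak type (1,1) inequality for the maximal difference quotient of a Lipschitz function, with
the quotients restricted to a compact interval. It follows from the Vitali covering theorem. -/
theorem mul_volume_le_lintegral_deriv {h : ℝ → ℝ} {Λ : ℝ≥0} (hh : LipschitzWith Λ h) {a b m : ℝ}
    (hm : 0 < m) {E : Set ℝ} (hE : E ⊆ Set.Icc a b)
    (hbad : ∀ τ ∈ E, ∃ u ∈ Set.Icc a b, m * |u - τ| < |h u - h τ|) :
    ENNReal.ofReal m * volume E ≤ 5 * ∫⁻ x in Set.Icc a b, ‖deriv h x‖ₑ := by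
  classical
  have hbad' : ∀ τ, ∃ u, τ ∈ E → u ∈ Set.Icc a b ∧ m * |u - τ| < |h u - h τ| := by
    intro τ
    by_cases hτ : τ ∈ E
    · obtain ⟨u, hu⟩ := hbad τ hτ
      exact ⟨u, fun _ => hu⟩
    · exact ⟨0, fun h => absurd h hτ⟩
  choose u hu using hbad'
  set c : ℝ → ℝ := fun τ => (τ + u τ) / 2 with hc
  set r : ℝ → ℝ := fun τ => |u τ - τ| / 2 with hr
  have hball : ∀ τ, Metric.closedBall (c τ) (r τ) = Set.uIcc τ (u τ) := by
    intro τ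
    rw [Real.closedBall_eq_Icc, Set.uIcc]
    simp only [hc, hr]
    rcases le_total τ (u τ) with h1 | h1
    · rw [abs_of_nonneg (by linarith), inf_eq_left.2 h1, sup_eq_right.2 h1]
      congr 1 <;> ring
    · rw [abs_of_nonpos (by linarith), inf_eq_right.2 h1, sup_eq_left.2 h1]
      congr 1 <;> ring
  have hne : ∀ τ ∈ E, 0 < r τ := by
    intro τ hτ
    have h1 := (hu τ hτ).2
    have : u τ - τ ≠ 0 := by
      intro h0
      have : u τ = τ := by linarith
      rw [this] at h1
      simp at h1
    simp only [hr]
    positivity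
  obtain ⟨w, hwE, hdisj, hcov⟩ := Vitali.exists_disjoint_subfamily_covering_enlargement_closedBall
    E c r (|b - a|) (by
      intro τ hτ
      have h1 := (hu τ hτ).1
      have h2 := hE hτ
      simp only [hr]
      have : |u τ - τ| ≤ b - a := by
        rw [abs_le]
        constructor <;> linarith [h1.1, h1.2, h2.1, h2.2]
      linarith [le_abs_self (b - a), abs_nonneg (u τ - τ)]) 5 (by norm_num)
  have hwc : w.Countable := hdisj.countable_of_nonempty_interior (by
    intro τ hτ
    refine ⟨c τ, ?_⟩
    exact Metric.ball_subset_interior_closedBall (Metric.mem_ball_self (hne τ (hwE hτ))))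
  have hcover : E ⊆ ⋃ τ ∈ w, Metric.closedBall (c τ) (5 * r τ) := by
    intro τ hτ
    obtain ⟨τ', hτ', hsub⟩ := hcov τ hτ
    refine Set.mem_biUnion hτ' (hsub ?_)
    rw [hball]
    exact Set.left_mem_uIcc
  have hone : ∀ τ ∈ w, ENNReal.ofReal m * volume (Metric.closedBall (c τ) (5 * r τ))
      ≤ 5 * ∫⁻ x in Metric.closedBall (c τ) (r τ), ‖deriv h x‖ₑ := by
    intro τ hτ
    have h1 := abs_sub_le_lintegral_deriv hh τ (u τ)
    rw [hball]
    refine le_trans ?_ (mul_le_mul_right h1 5)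
    rw [Real.volume_closedBall, ← ENNReal.ofReal_mul hm.le]
    have : (5 : ℝ≥0∞) = ENNReal.ofReal 5 := by norm_num
    rw [this, ← ENNReal.ofReal_mul (by norm_num)]
    apply ENNReal.ofReal_le_ofReal
    simp only [hr]
    linarith [(hu τ (hwE hτ)).2]
  calc ENNReal.ofReal m * volume E
      ≤ ENNReal.ofReal m * ∑' τ : w, volume (Metric.closedBall (c τ) (5 * r τ)) := by
        gcongr
        exact (measure_mono hcover).trans (measure_biUnion_le volume hwc _)
    _ = ∑' τ : w, ENNReal.ofReal m * volume (Metric.closedBall (c τ) (5 * r τ)) :=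
        ENNReal.tsum_mul_left.symm
    _ ≤ ∑' τ : w, 5 * ∫⁻ x in Metric.closedBall (c τ) (r τ), ‖deriv h x‖ₑ :=
        ENNReal.tsum_le_tsum fun τ => hone τ τ.2
    _ = 5 * ∫⁻ x in ⋃ τ ∈ w, Metric.closedBall (c τ) (r τ), ‖deriv h x‖ₑ := by
        rw [ENNReal.tsum_mul_left, lintegral_biUnion hwc
          (fun τ _ => Metric.isClosed_closedBall.measurableSet) hdisj]
    _ ≤ 5 * ∫⁻ x in Set.Icc a b, ‖deriv h x‖ₑ := by
        gcongr
        refine Set.iUnion₂_subset fun τ hτ => ?_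
        rw [hball]
        exact Set.uIcc_subset_Icc (hE (hwE hτ)) (hu τ (hwE hτ)).1

/-- If a Lipschitz function on `[a, b]` deviates by at least `2 * P` from its value at `a`, while
its net increment is at most `P`, then the positive part of its derivative has integral at least
`P`, and at least a third of the total variation. -/
theorem integral_posPart_deriv {h : ℝ → ℝ} {Λ : ℝ≥0} (hh : LipschitzWith Λ h) {a b ξ P : ℝ}
    (hξ : ξ ∈ Set.Icc a b) (hup : 2 * P ≤ |h ξ - h a|) (hnet : |h b - h a| ≤ P) :
    ∃ I : ℝ, P ≤ I ∧ ∫⁻ x in Set.Icc a b, ENNReal.ofReal (deriv h x) = ENNReal.ofReal I ∧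
      ∫⁻ x in Set.Icc a b, ‖deriv h x‖ₑ ≤ ENNReal.ofReal (3 * I) := by
  have hint : ∀ u v, IntervalIntegrable (deriv h) volume u v := fun u v =>
    (hh.lipschitzOnWith (s := Set.uIcc u v)).absolutelyContinuousOnInterval.intervalIntegrable_deriv
  have hftc : ∀ u v, ∫ x in u..v, deriv h x = h v - h u := fun u v =>
    (hh.lipschitzOnWith (s := Set.uIcc u v)).absolutelyContinuousOnInterval.integral_deriv_eq_sub
  have hposint : ∀ u v, IntervalIntegrable (fun x => max (deriv h x) 0) volume u v := fun u v => by
    have := hint u v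
    exact ⟨this.1.pos_part, this.2.pos_part⟩
  have hab : a ≤ b := hξ.1.trans hξ.2
  have hle : ∀ u v, u ≤ v → h v - h u ≤ ∫ x in u..v, max (deriv h x) 0 := by
    intro u v huv
    rw [← hftc]
    exact intervalIntegral.integral_mono_on huv (hint u v) (hposint u v) fun x _ => le_max_left _ _
  have hnn : ∀ u v, u ≤ v → 0 ≤ ∫ x in u..v, max (deriv h x) 0 := fun u v huv =>
    intervalIntegral.integral_nonneg huv fun x _ => le_max_right _ _
  have hsplit := intervalIntegral.integral_add_adjacent_intervals (hposint a ξ) (hposint ξ b)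
  set I := ∫ x in a..b, max (deriv h x) 0 with hI
  have hPI : P ≤ I := by
    have h1 := hle a ξ hξ.1
    have h2 := hle ξ b hξ.2
    have h3 := hnn a ξ hξ.1
    have h4 := hnn ξ b hξ.2
    rcases le_total 0 (h ξ - h a) with h0 | h0
    · rw [abs_of_nonneg h0] at hup
      have := abs_nonneg (h b - h a)
      linarith
    · rw [abs_of_nonpos h0] at hup
      have := (abs_le.1 hnet).1
      linarith
  have hIcc : ∀ f : ℝ → ℝ, ∫ x in Set.Icc a b, f x = ∫ x in a..b, f x := fun f => by
    rw [intervalIntegral.integral_of_le hab, integral_Icc_eq_integral_Ioc]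
  have hIccint : ∀ f : ℝ → ℝ, IntervalIntegrable f volume a b →
      Integrable f (volume.restrict (Set.Icc a b)) := fun f hf => by
    exact (intervalIntegrable_iff_integrableOn_Icc_of_le hab).1 hf
  refine ⟨I, hPI, ?_, ?_⟩
  · rw [hI, ← hIcc, ofReal_integral_eq_lintegral_ofReal (hIccint _ (hposint a b))
      (Eventually.of_forall fun x => le_max_right _ _)]
    congr 1
    ext x
    rcases le_total 0 (deriv h x) with h0 | h0
    · rw [max_eq_left h0]
    · rw [max_eq_right h0, ENNReal.ofReal_of_nonpos h0, ENNReal.ofReal_zero]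
  · rw [← ofReal_integral_norm_eq_lintegral_enorm (hIccint _ (hint a b)), hIcc]
    apply ENNReal.ofReal_le_ofReal
    have h5 : ∀ x, ‖deriv h x‖ = 2 * max (deriv h x) 0 - deriv h x := by
      intro x
      rw [Real.norm_eq_abs]
      rcases le_total 0 (deriv h x) with h0 | h0
      · rw [max_eq_left h0, abs_of_nonneg h0]; ring
      · rw [max_eq_right h0, abs_of_nonpos h0]; ring
    simp_rw [h5]
    rw [intervalIntegral.integral_sub ((hposint a b).const_mul 2) (hint a b),
      intervalIntegral.integral_const_mul, hftc]
    have := (abs_le.1 hnet).1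
    linarith

/-- A mean value theorem with control of all increments. If a Lipschitz function on `[a, b]`
deviates by `2 * P` from its value at `a`, while its net increment is at most `P`, then at some
point the derivative is at least a fixed multiple of `P / (b - a)`, and the increments from that
point are bounded by the square root of the derivative. The point may be chosen outside a
prescribed set of small measure.

Otherwise the maximal difference quotient exceeds a large multiple of the square root of the
derivative wherever the derivative is not small, and summing the weak type inequality over the
levels `4⁻ᵏ⁻¹ * Λ < deriv h ≤ 4⁻ᵏ * Λ` bounds the integral of the positive part of the derivative
by half of itself. -/
theorem exists_deriv_ge_and_increment_le {h : ℝ → ℝ} {Λ : ℝ≥0} (hh : LipschitzWith Λ h)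
    {a b ξ P : ℝ} (hab : a < b) (hP : 0 < P) (hξ : ξ ∈ Set.Icc a b) (hup : 2 * P ≤ |h ξ - h a|)
    (hnet : |h b - h a| ≤ P) {X : Set ℝ} (hX : MeasurableSet X)
    (hXv : Λ * volume X ≤ ENNReal.ofReal (P / 8)) :
    ∃ τ ∈ Set.Icc a b, τ ∉ X ∧ P / (8 * (b - a)) ≤ deriv h τ ∧
      ∀ u ∈ Set.Icc a b, |h u - h τ| ≤ 240 * √(Λ * deriv h τ) * |u - τ| := by
  by_contra! hcon
  obtain ⟨I, hPI, hI, hA⟩ := integral_posPart_deriv hh hξ hup hnet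
  have hI0 : 0 < I := hP.trans_le hPI
  have hba : 0 < b - a := sub_pos.2 hab
  set g := P / (8 * (b - a)) with hg
  have hg0 : 0 < g := by positivity
  have hΛ : ∀ x, deriv h x ≤ Λ := fun x =>
    (le_abs_self _).trans (norm_deriv_le_of_lipschitz hh)
  have hΛ0 : (0 : ℝ) < Λ := by
    by_contra h0
    have h1 : Λ = 0 := by
      have : (Λ : ℝ) = 0 := le_antisymm (not_lt.1 h0) Λ.2
      exact_mod_cast this
    have := hh.dist_le_mul ξ a
    rw [Real.dist_eq, h1] at this
    simp at this
    rw [this] at hup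
    simp at hup
    linarith
  set E : ℕ → Set ℝ := fun k => {τ | τ ∈ Set.Icc a b ∧ τ ∉ X ∧ g ≤ deriv h τ ∧
    (1 / 4 : ℝ) ^ (k + 1) * Λ < deriv h τ ∧ deriv h τ ≤ (1 / 4 : ℝ) ^ k * Λ} with hE
  have hmd : Measurable (deriv h) := measurable_deriv h
  have hEm : ∀ k, MeasurableSet (E k) := by
    intro k
    simp only [hE]
    exact measurableSet_Icc.inter (hX.compl.inter ((measurableSet_le measurable_const hmd).inter
      ((measurableSet_lt measurable_const hmd).inter (measurableSet_le hmd measurable_const))))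
  -- With the constant `240` the weak type inequality yields `I / 8` times a geometric progression.
  have hEv : ∀ k, ENNReal.ofReal ((1 / 4 : ℝ) ^ k * Λ) * volume (E k)
      ≤ ENNReal.ofReal (I / 8) * (2⁻¹ : ℝ≥0∞) ^ k := by
    intro k
    have hmk : (0 : ℝ) < 240 * ((1 / 2 : ℝ) ^ (k + 1) * Λ) := by positivity
    have h1 := mul_volume_le_lintegral_deriv hh (a := a) (b := b) hmk (E := E k)
      (fun τ hτ => hτ.1) (by
        intro τ hτ
        obtain ⟨h1, h2, h3, h4, -⟩ := hτ
        obtain ⟨u, hu, hlt⟩ := hcon τ h1 h2 h3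
        refine ⟨u, hu, lt_of_le_of_lt ?_ hlt⟩
        gcongr
        apply Real.le_sqrt_of_sq_le
        calc ((1 / 2 : ℝ) ^ (k + 1) * Λ) ^ 2 = Λ * ((1 / 4 : ℝ) ^ (k + 1) * Λ) := by
              rw [mul_pow, ← pow_mul, mul_comm (k + 1) 2, pow_mul]; norm_num; ring
          _ ≤ Λ * deriv h τ := by gcongr)
    have h2 : ENNReal.ofReal ((1 / 4 : ℝ) ^ k * Λ)
        = ENNReal.ofReal ((1 / 120) * (1 / 2) ^ k)
          * ENNReal.ofReal (240 * ((1 / 2 : ℝ) ^ (k + 1) * Λ)) := by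
      rw [← ENNReal.ofReal_mul (by positivity)]
      congr 1
      have : (1 / 4 : ℝ) ^ k = (1 / 2) ^ k * (1 / 2) ^ k := by
        rw [← mul_pow]; norm_num
      rw [this]; ring
    have h3 : (2⁻¹ : ℝ≥0∞) ^ k = ENNReal.ofReal ((1 / 2) ^ k) := by
      rw [ENNReal.ofReal_pow (by norm_num)]
      congr 1
      rw [one_div, ENNReal.ofReal_inv_of_pos (by norm_num)]
      norm_num
    rw [h2, h3, mul_assoc]
    calc _ ≤ ENNReal.ofReal ((1 / 120) * (1 / 2) ^ k) * (5 * ENNReal.ofReal (3 * I)) := by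
          exact mul_le_mul_right (h1.trans (mul_le_mul_right hA 5)) _
      _ = ENNReal.ofReal (I / 8) * ENNReal.ofReal ((1 / 2) ^ k) := by
          have : (5 : ℝ≥0∞) = ENNReal.ofReal 5 := by norm_num
          rw [this, ← ENNReal.ofReal_mul (by norm_num), ← ENNReal.ofReal_mul (by positivity),
            ← ENNReal.ofReal_mul (by positivity)]
          congr 1; ring
  have hpt : ∀ τ ∈ Set.Icc a b, ENNReal.ofReal (deriv h τ) ≤
      X.indicator (fun _ => (Λ : ℝ≥0∞)) τ + ENNReal.ofReal g
        + ∑' k, (E k).indicator (fun _ => ENNReal.ofReal ((1 / 4 : ℝ) ^ k * Λ)) τ := by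
    intro τ hτ
    by_cases hτX : τ ∈ X
    · refine le_add_right (le_add_right ?_)
      rw [Set.indicator_of_mem hτX, ← ENNReal.ofReal_coe_nnreal]
      exact ENNReal.ofReal_le_ofReal (hΛ τ)
    by_cases hτg : deriv h τ < g
    · refine le_add_right (le_add_left ?_)
      exact ENNReal.ofReal_le_ofReal hτg.le
    push Not at hτg
    refine le_add_left ?_
    have hd0 : 0 < deriv h τ := hg0.trans_le hτg
    obtain ⟨k, hk1, hk2⟩ := exists_nat_pow_near_of_lt_one (x := deriv h τ / Λ) (y := 1 / 4)
      (by positivity) (by rw [div_le_one hΛ0]; exact hΛ τ) (by norm_num) (by norm_num)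
    have hmem : τ ∈ E k := by
      refine ⟨hτ, hτX, hτg, ?_, ?_⟩
      · rwa [lt_div_iff₀ hΛ0] at hk1
      · rwa [div_le_iff₀ hΛ0] at hk2
    calc ENNReal.ofReal (deriv h τ) ≤ ENNReal.ofReal ((1 / 4 : ℝ) ^ k * Λ) :=
          ENNReal.ofReal_le_ofReal hmem.2.2.2.2
      _ = (E k).indicator (fun _ => ENNReal.ofReal ((1 / 4 : ℝ) ^ k * Λ)) τ := by
          rw [Set.indicator_of_mem hmem]
      _ ≤ _ := ENNReal.le_tsum (f := fun k =>
          (E k).indicator (fun _ => ENNReal.ofReal ((1 / 4 : ℝ) ^ k * Λ)) τ) k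
  have hfin : ENNReal.ofReal I ≤ ENNReal.ofReal (P / 8 + P / 8 + I / 4) := by
    calc ENNReal.ofReal I = ∫⁻ x in Set.Icc a b, ENNReal.ofReal (deriv h x) := hI.symm
      _ ≤ ∫⁻ τ in Set.Icc a b, (X.indicator (fun _ => (Λ : ℝ≥0∞)) τ + ENNReal.ofReal g
        + ∑' k, (E k).indicator (fun _ => ENNReal.ofReal ((1 / 4 : ℝ) ^ k * Λ)) τ) :=
          setLIntegral_mono' measurableSet_Icc hpt
      _ = (∫⁻ τ in Set.Icc a b, X.indicator (fun _ => (Λ : ℝ≥0∞)) τ)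
          + (∫⁻ τ in Set.Icc a b, ENNReal.ofReal g)
          + ∑' k, ∫⁻ τ in Set.Icc a b,
            (E k).indicator (fun _ => ENNReal.ofReal ((1 / 4 : ℝ) ^ k * Λ)) τ := by
          have hXi : Measurable (X.indicator fun _ => (Λ : ℝ≥0∞)) := measurable_const.indicator hX
          rw [lintegral_add_left (hXi.add_const _), lintegral_add_left hXi,
            lintegral_tsum fun k => (measurable_const.indicator (hEm k)).aemeasurable]
      _ ≤ ENNReal.ofReal (P / 8) + ENNReal.ofReal (P / 8)
          + ∑' k : ℕ, ENNReal.ofReal (I / 8) * (2⁻¹ : ℝ≥0∞) ^ k := by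
          gcongr with k
          · rw [lintegral_indicator_const hX]
            exact (mul_le_mul_right (Measure.restrict_apply_le _ _) _).trans hXv
          · rw [lintegral_const, Measure.restrict_apply_univ, Real.volume_Icc,
              ← ENNReal.ofReal_mul hg0.le]
            apply ENNReal.ofReal_le_ofReal
            rw [hg]
            apply le_of_eq
            field_simp
          · rw [lintegral_indicator_const (hEm k)]
            exact (mul_le_mul_right (Measure.restrict_apply_le _ _) _).trans (hEv k)
      _ = ENNReal.ofReal (P / 8 + P / 8 + I / 4) := by
          rw [ENNReal.tsum_mul_left, ENNReal.tsum_geometric, ENNReal.one_sub_inv_two, inv_inv]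
          have : (2 : ℝ≥0∞) = ENNReal.ofReal 2 := by norm_num
          rw [this, ← ENNReal.ofReal_mul (by positivity), ← ENNReal.ofReal_add (by positivity)
            (by positivity), ← ENNReal.ofReal_add (by positivity) (by positivity)]
          congr 1; ring
  rw [ENNReal.ofReal_le_ofReal_iff (by positivity)] at hfin
  linarith

/-! ### A directional derivative that is not a Fréchet derivative can be improved nearby -/

/-- Near `x`, every short segment can be approximated by a segment inside `M`, with an error that
is small compared to the distance scale. -/
def ApproximableAt {H : Type*} [NormedAddCommGroup H] [NormedSpace ℝ H] (M : Set H) (x : H) :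
    Prop :=
  ∀ ε > 0, ∃ δ₀ > 0, ∀ δ, 0 < δ → δ < δ₀ → ∀ A B : H, ‖A - x‖ ≤ δ → ‖B - x‖ ≤ δ →
    ∃ A' B' : H, ‖A' - A‖ ≤ ε * δ ∧ ‖B' - B‖ ≤ ε * δ ∧ segment ℝ A' B' ⊆ M

theorem abs_sub_le_of_lipschitz_two {H : Type*} [NormedAddCommGroup H] {F : H → ℝ}
    (hF : LipschitzWith 2 F) (y z : H) : |F y - F z| ≤ 2 * ‖y - z‖ := by
  have := hF.dist_le_mul y z
  rwa [Real.dist_eq, dist_eq_norm] at this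

section Wedge

variable {H : Type*} [NormedAddCommGroup H] [InnerProductSpace ℝ H]

open scoped InnerProductSpace

/-- The velocity of a side of a flat wedge differs from the unit vector `e` by an amount of first
order in the slope `κ`, while its length differs from one by an amount of second order only. -/
theorem wedge_velocity {e v z : H} {κ ε R : ℝ} (he : ‖e‖ = 1) (hκ : 0 < κ) (hκ4 : κ ≤ 1 / 4)
    (hε : 4 * ε ≤ κ ^ 2) (hR : 0 < R) (hv : ‖v‖ ≤ κ * R)
    (hz : ‖z - (v + R • e)‖ ≤ 2 * ε * R) :
    ‖(R + ⟪v, e⟫_ℝ)⁻¹ • z - e‖ ≤ 2 * κ ∧ |‖(R + ⟪v, e⟫_ℝ)⁻¹ • z‖ - 1| ≤ 2 * κ ^ 2 := by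
  set ξ := ⟪v, e⟫_ℝ with hξ
  have hξa : |ξ| ≤ ‖v‖ := by simpa [he] using abs_real_inner_le_norm v e
  have hξb := abs_le.1 hξa
  have hq : R * (3 / 4) ≤ R + ξ := by nlinarith
  have hq0 : 0 < R + ξ := by nlinarith
  have hee : ⟪e, e⟫_ℝ = 1 := by rw [real_inner_self_eq_norm_sq, he]; norm_num
  have horth : ⟪v - ξ • e, e⟫_ℝ = 0 := by
    rw [inner_sub_left, real_inner_smul_left, hee, ← hξ]; ring
  have hperp : ‖v - ξ • e‖ ≤ ‖v‖ := by
    have h1 : ‖v‖ ^ 2 = ‖v - ξ • e‖ ^ 2 + ξ ^ 2 := by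
      have h2 : v = (v - ξ • e) + ξ • e := by abel
      have h3 : ⟪v - ξ • e, ξ • e⟫_ℝ = 0 := by rw [real_inner_smul_right, horth, mul_zero]
      have h4 := norm_add_sq_real (v - ξ • e) (ξ • e)
      rw [h3, ← h2, norm_smul, he] at h4
      rw [h4]; simp
    refine (pow_le_pow_iff_left₀ (norm_nonneg _) (norm_nonneg _) two_ne_zero).1 ?_
    rw [h1]
    linarith [sq_nonneg ξ]
  have hinv : (R + ξ)⁻¹ * R ≤ 4 / 3 := by
    rw [inv_mul_le_iff₀ hq0]; linarith
  have hinv0 : 0 < (R + ξ)⁻¹ := inv_pos.2 hq0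
  set u := (R + ξ)⁻¹ • (v - ξ • e) with hu
  set d := (R + ξ)⁻¹ • (z - (v + R • e)) with hd
  have hun : ‖u‖ ≤ 4 / 3 * κ := by
    rw [hu, norm_smul, Real.norm_of_nonneg hinv0.le]
    calc (R + ξ)⁻¹ * ‖v - ξ • e‖ ≤ (R + ξ)⁻¹ * (κ * R) := by gcongr; exact hperp.trans hv
      _ = ((R + ξ)⁻¹ * R) * κ := by ring
      _ ≤ 4 / 3 * κ := by gcongr
  have hdn : ‖d‖ ≤ 2 / 3 * κ ^ 2 := by
    have hε0 : 0 ≤ ε := by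
      have := norm_nonneg (z - (v + R • e))
      by_contra h0
      push Not at h0
      nlinarith
    rw [hd, norm_smul, Real.norm_of_nonneg hinv0.le]
    calc (R + ξ)⁻¹ * ‖z - (v + R • e)‖ ≤ (R + ξ)⁻¹ * (2 * ε * R) := by gcongr
      _ = ((R + ξ)⁻¹ * R) * (2 * ε) := by ring
      _ ≤ 4 / 3 * (2 * ε) := by gcongr
      _ ≤ 2 / 3 * κ ^ 2 := by linarith
  have hw : (R + ξ)⁻¹ • z = (e + u) + d := by
    have : z = (R + ξ) • e + (v - ξ • e) + (z - (v + R • e)) := by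
      rw [add_smul]; abel
    conv_lhs => rw [this]
    rw [smul_add, smul_add, smul_smul, inv_mul_cancel₀ hq0.ne', one_smul]
  have hwbar : ‖e + u‖ ^ 2 = 1 + ‖u‖ ^ 2 := by
    have : ⟪e, u⟫_ℝ = 0 := by
      rw [hu, real_inner_smul_right, real_inner_comm, horth, mul_zero]
    rw [norm_add_sq_real, this, he]; ring
  have hwb1 : 1 ≤ ‖e + u‖ := by nlinarith [norm_nonneg (e + u), sq_nonneg ‖u‖]
  have hwb2 : ‖e + u‖ ≤ 1 + κ ^ 2 := by
    have : ‖u‖ ^ 2 ≤ (4 / 3 * κ) ^ 2 := by gcongr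
    nlinarith [norm_nonneg (e + u)]
  rw [hw]
  constructor
  · have : e + u + d - e = u + d := by abel
    rw [this]
    have := norm_add_le u d
    nlinarith
  · have h1 := norm_add_le (e + u) d
    have h2 := norm_sub_le (e + u + d) d
    rw [add_sub_cancel_right] at h2
    rw [abs_le]
    constructor <;> nlinarith [sq_nonneg κ]

/-- Increments from a point `x'` close to the line `x + ℝ • e` are compared with the increments
from `x`. Long increments are controlled by the distance of `x'` to the line, which is small
compared to the distance of the base point to the ends of the interval `[-R, R]`. -/
theorem increment_le_of_near_line {F : H → ℝ} (hF : LipschitzWith 2 F) {x e x' : H}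
    {c κ θ ε R τ B : ℝ} (he : ‖e‖ = 1) (hκ : 0 < κ) (hκ1 : κ ≤ 1) (hθ : 0 < θ) (hθ1 : θ ≤ 1)
    (hε : 100 * ε = κ * θ) (hR : 0 < R) (hB : 0 ≤ B)
    (hline : ∀ u, |u| ≤ 5 / κ * R → |F (x + u • e) - F x - c * u| ≤ ε * |u|)
    (hτθ : θ * R ≤ R - |τ|)
    (hdev : ‖x' - (x + τ • e)‖ ≤ ε * R + 4 * κ * (R - |τ|))
    (hnear : ∀ u ∈ Set.Icc (-R) R, |F (x' + (u - τ) • e) - F x' - c * (u - τ)| ≤ B * |u - τ|)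
    (t : ℝ) :
    |F (x' + t • e) - F x' - (F (x + t • e) - F x)| ≤ (B + 19 * κ) * |t| := by
  have hε0 : 0 < ε := by have := mul_pos hκ hθ; linarith
  have hεκ : 100 * ε ≤ κ := by nlinarith
  have hτR : |τ| ≤ R := by nlinarith
  have hT : 5 ≤ 5 / κ := by rw [le_div_iff₀ hκ]; linarith
  have hκT : κ * (5 / κ * R) = 5 * R := by field_simp
  by_cases hin : τ + t ∈ Set.Icc (-R) R
  · have h1 := hnear (τ + t) hin
    rw [add_sub_cancel_left] at h1
    have ht : |t| ≤ 5 / κ * R := by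
      have : |t| ≤ 2 * R := by
        have := abs_le.1 hτR
        rw [abs_le]; constructor <;> linarith [hin.1, hin.2]
      nlinarith
    have h2 := hline t ht
    have h3 : F (x' + t • e) - F x' - (F (x + t • e) - F x)
        = (F (x' + t • e) - F x' - c * t) - (F (x + t • e) - F x - c * t) := by ring
    rw [h3]
    refine (abs_sub _ _).trans ?_
    nlinarith [abs_nonneg t]
  · have htd : R - |τ| ≤ |t| := by
      by_contra hlt
      push Not at hlt
      apply hin
      have h1 := neg_abs_le τ
      have h2 := le_abs_self τ
      have h3 := neg_abs_le t
      have h4 := le_abs_self t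
      exact ⟨by linarith, by linarith⟩
    have htθ : θ * R ≤ |t| := hτθ.trans htd
    have hεR : 100 * (ε * R) ≤ κ * |t| := by
      calc 100 * (ε * R) = κ * (θ * R) := by rw [← mul_assoc, hε]; ring
        _ ≤ κ * |t| := by gcongr
    have hdev' : ‖x' - (x + τ • e)‖ ≤ (4 + 1 / 100) * κ * |t| := by
      have : 4 * κ * (R - |τ|) ≤ 4 * κ * |t| := by gcongr
      linarith
    have h1 := abs_sub_le_of_lipschitz_two hF (x' + t • e) (x + τ • e + t • e)
    have h2 := abs_sub_le_of_lipschitz_two hF x' (x + τ • e)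
    rw [add_sub_add_right_eq_sub] at h1
    have h3 : |F (x + τ • e + t • e) - F (x + τ • e) - (F (x + t • e) - F x)| ≤ 1.5 * κ * |t| := by
      rcases le_or_gt |t| (4 / κ * R) with hle | hgt
      · have hsum : 4 / κ * R + R ≤ 5 / κ * R := by
          have : 1 ≤ 1 / κ := by rw [le_div_iff₀ hκ]; linarith
          have h5 : 5 / κ * R = 4 / κ * R + 1 / κ * R := by ring
          nlinarith
        have ha := hline (τ + t) ((abs_add_le τ t).trans (by linarith))
        have hb := hline τ (by nlinarith)
        have hc := hline t (by linarith)
        rw [add_smul, ← add_assoc] at ha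
        have h5 : F (x + τ • e + t • e) - F (x + τ • e) - (F (x + t • e) - F x)
          = (F (x + τ • e + t • e) - F x - c * (τ + t)) - (F (x + τ • e) - F x - c * τ)
            - (F (x + t • e) - F x - c * t) := by ring
        rw [h5]
        refine (abs_sub _ _).trans ((add_le_add_left (abs_sub _ _) _).trans ?_)
        have h6 : ε * |τ + t| ≤ ε * (|τ| + |t|) := by gcongr; exact abs_add_le τ t
        have h7 : ε * |τ| ≤ ε * R := by gcongr
        have h8 : ε * |t| ≤ κ / 100 * |t| := by gcongr; linarith
        nlinarith [abs_nonneg t]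
      · have ha := abs_sub_le_of_lipschitz_two hF (x + τ • e + t • e) (x + t • e)
        have hb := abs_sub_le_of_lipschitz_two hF (x + τ • e) x
        have h5 : x + τ • e + t • e - (x + t • e) = τ • e := by abel
        rw [h5, norm_smul, he, Real.norm_eq_abs] at ha
        rw [add_sub_cancel_left, norm_smul, he, Real.norm_eq_abs] at hb
        have h6 : F (x + τ • e + t • e) - F (x + τ • e) - (F (x + t • e) - F x)
          = (F (x + τ • e + t • e) - F (x + t • e)) - (F (x + τ • e) - F x) := by ring
        rw [h6]
        refine (abs_sub _ _).trans ?_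
        have h7 : κ * (4 / κ * R) < κ * |t| := by gcongr
        have h8 : κ * (4 / κ * R) = 4 * R := by field_simp
        nlinarith [abs_nonneg t]
    have h4 : F (x' + t • e) - F x' - (F (x + t • e) - F x)
        = (F (x' + t • e) - F (x + τ • e + t • e)) - (F x' - F (x + τ • e))
          + (F (x + τ • e + t • e) - F (x + τ • e) - (F (x + t • e) - F x)) := by ring
    rw [h4]
    refine (abs_add_le _ _).trans ((add_le_add_left (abs_sub _ _) _).trans ?_)
    have : 0 ≤ B * |t| := by positivity
    have := mul_nonneg hκ.le (abs_nonneg t)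
    linarith

/-- Normalisation of the direction: a derivative `c + D` along a vector whose length is one up to
second order yields a directional derivative exceeding `c` by at least `D / 2`. -/
theorem exists_unit_direction {F : H → ℝ} (hF : LipschitzWith 2 F) {x' w : H} {c D κ : ℝ}
    (hκ4 : κ ≤ 1 / 4) (hκ : 0 < κ) (hD : 8 * κ ^ 2 ≤ D)
    (hder : HasLineDerivAt ℝ F (c + D) x' w) (hw : |‖w‖ - 1| ≤ 2 * κ ^ 2) :
    ∃ e' : H, ∃ c' : ℝ, ‖e'‖ = 1 ∧ HasLineDerivAt ℝ F c' x' e' ∧ c + D / 2 ≤ c' := by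
  have hw' := abs_le.1 hw
  have hw0 : 0 < ‖w‖ := by nlinarith
  have he' : ‖‖w‖⁻¹ • w‖ = 1 := by
    rw [norm_smul, norm_inv, norm_norm, inv_mul_cancel₀ hw0.ne']
  refine ⟨‖w‖⁻¹ • w, ‖w‖⁻¹ * (c + D), he', hder.smul _, ?_⟩
  set c' := ‖w‖⁻¹ * (c + D) with hc'
  have h1 : |c'| ≤ 2 := by
    have := (hder.smul ‖w‖⁻¹).le_of_lipschitz hF
    rw [he'] at this
    simpa [hc'] using this
  have h2 : c + D = c' * ‖w‖ := by rw [hc']; field_simp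
  have h3 : c + D - c' ≤ 4 * κ ^ 2 := by
    calc c + D - c' = c' * (‖w‖ - 1) := by rw [h2]; ring
      _ ≤ |c' * (‖w‖ - 1)| := le_abs_self _
      _ = |c'| * |‖w‖ - 1| := abs_mul _ _
      _ ≤ 2 * (2 * κ ^ 2) := by gcongr
      _ = 4 * κ ^ 2 := by ring
  linarith

theorem hasLineDerivAt_of_hasDerivAt_affine {F : H → ℝ} {a w : H} {R c D τ : ℝ}
    (h : HasDerivAt (fun s => F (a + (s + R) • w) - c * s) D τ) :
    HasLineDerivAt ℝ F (c + D) (a + (τ + R) • w) w := by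
  have h1 : HasDerivAt (fun s => F (a + (s + R) • w)) (c + D) τ := by
    have := h.add ((hasDerivAt_id τ).const_mul c)
    simp only [id, mul_one] at this
    rw [add_comm c D]
    refine this.congr_of_eventuallyEq (Eventually.of_forall fun s => ?_)
    simp
  unfold HasLineDerivAt
  have h2 : HasDerivAt (fun t => F (a + (τ + t + R) • w)) (c + D) 0 :=
    HasDerivAt.comp_const_add (f := fun s => F (a + (s + R) • w)) τ 0 (by simpa using h1)
  refine h2.congr_of_eventuallyEq (Eventually.of_forall fun t => ?_)
  simp only
  congr 1
  module

theorem lipschitzWith_affine_sub_linear {F : H → ℝ} (hF : LipschitzWith 2 F) {a w : H} {R c : ℝ}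
    (hc : |c| ≤ 2) (hw : ‖w‖ ≤ 3 / 2) :
    LipschitzWith 5 (fun s => F (a + (s + R) • w) - c * s) := by
  refine LipschitzWith.of_dist_le_mul fun s t => ?_
  rw [Real.dist_eq, Real.dist_eq]
  have h1 := abs_sub_le_of_lipschitz_two hF (a + (s + R) • w) (a + (t + R) • w)
  have h2 : a + (s + R) • w - (a + (t + R) • w) = (s - t) • w := by module
  rw [h2, norm_smul, Real.norm_eq_abs] at h1
  have h3 : F (a + (s + R) • w) - c * s - (F (a + (t + R) • w) - c * t)
      = (F (a + (s + R) • w) - F (a + (t + R) • w)) - c * (s - t) := by ring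
  rw [h3]
  refine (abs_sub _ _).trans ?_
  rw [abs_mul]
  have h4 : |c| * |s - t| ≤ 2 * |s - t| := by gcongr
  have h5 : |s - t| * ‖w‖ ≤ |s - t| * (3 / 2) := by gcongr
  push_cast
  linarith

set_option maxHeartbeats 4000000 in
/-- The improvement of a directional derivative at a fixed scale `R`. The function `F` is nearly
affine with slope `c` along the line `x + ℝ • e`, but deviates by `η * ‖v‖` from its linear
prediction at `x + v`, where `‖v‖ = κ * R`. Two segments approximate the sides of the wedge with
vertices `x - R • e`, `x + v`, `x + R • e`. They need not have a common end point, since the jump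
between them is negligible away from the vertex. -/
theorem exists_improved_direction_on_wedge {F : H → ℝ} (hF : LipschitzWith 2 F)
    {x e v p m₁ m₂ b : H} {c η κ θ ε R : ℝ} (he : ‖e‖ = 1) (hc : |c| ≤ 2) (hη : 0 < η)
    (hη1 : η ≤ 1) (hκ : 30000 * κ = η) (hθ : 1280 * θ = η * κ) (hε : 100 * ε = κ * θ) (hR : 0 < R)
    (hline : ∀ u, |u| ≤ 5 / κ * R → |F (x + u • e) - F x - c * u| ≤ ε * |u|)
    (hv : ‖v‖ = κ * R) (hbig : η * ‖v‖ ≤ |F (x + v) - F x - c * ⟪v, e⟫_ℝ|)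
    (hp : ‖p - (x - R • e)‖ ≤ ε * R) (hm₁ : ‖m₁ - (x + v)‖ ≤ ε * R)
    (hm₂ : ‖m₂ - (x + v)‖ ≤ ε * R) (hb : ‖b - (x + R • e)‖ ≤ ε * R) :
    ∃ y ∈ segment ℝ p m₁ ∪ segment ℝ m₂ b, ‖y - x‖ ≤ 2 * R ∧ ∃ e' : H, ∃ c' : ℝ, ‖e'‖ = 1 ∧
      HasLineDerivAt ℝ F c' y e' ∧ c + η * κ / 128 ≤ c' ∧
      ∀ t : ℝ, |F (y + t • e) - F y - (F (x + t • e) - F x)| ≤ 1200 * √(c' - c) * |t| := by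
  -- `κ` is so small that terms of order `κ ^ 2` are negligible compared to the gain, of order
  -- `η * κ`. The proportion `θ` of the parameter interval may be discarded without losing the
  -- gain, and `ε` is negligible even at the distance `θ * R`.
  have hκ0 : 0 < κ := by linarith
  have hκ1 : κ ≤ 1 / 30000 := by linarith
  have hθ0 : 0 < θ := by have := mul_pos hη hκ0; linarith
  have hθκ : 1280 * θ ≤ κ := by rw [hθ]; exact mul_le_of_le_one_left hκ0.le hη1
  have hε0 : 0 < ε := by have := mul_pos hκ0 hθ0; linarith
  have hεκ2 : 128000 * ε ≤ κ ^ 2 := by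
    have := mul_le_mul_of_nonneg_left hθκ hκ0.le
    rw [sq]; linarith
  have hεκ : 128000 * ε ≤ κ := by
    have := mul_le_mul_of_nonneg_left (hκ1.trans (by norm_num : (1 : ℝ) / 30000 ≤ 1)) hκ0.le
    rw [sq] at hεκ2; linarith
  have hεη : 128000 * ε ≤ η * κ := by
    have h1 : κ * (1280 * θ) = κ * (η * κ) := by rw [hθ]
    have h2 : κ * (η * κ) ≤ 1 * (η * κ) := by gcongr; linarith
    linarith
  set ξ := ⟪v, e⟫_ℝ with hξ
  have hξa : |ξ| ≤ κ * R := by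
    rw [← hv]
    simpa [he] using abs_real_inner_le_norm v e
  have hξb := abs_le.1 hξa
  have hκR : κ * R ≤ R / 30000 := by
    have := mul_le_mul_of_nonneg_right hκ1 hR.le
    linarith
  set w₁ := (R + ξ)⁻¹ • (m₁ - p) with hw₁
  set w₂ := (R + -ξ)⁻¹ • (b - m₂) with hw₂
  have hR1 : 0 < R + ξ := by linarith
  have hR2 : 0 < R + -ξ := by linarith
  obtain ⟨hw1a, hw1b⟩ : ‖w₁ - e‖ ≤ 2 * κ ∧ |‖w₁‖ - 1| ≤ 2 * κ ^ 2 := by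
    refine wedge_velocity (ε := ε) he hκ0 (by linarith) (by linarith) hR hv.le ?_
    have : m₁ - p - (v + R • e) = (m₁ - (x + v)) - (p - (x - R • e)) := by module
    rw [this]
    refine (norm_sub_le _ _).trans ?_
    linarith
  obtain ⟨hw2a, hw2b⟩ : ‖w₂ - e‖ ≤ 2 * κ ∧ |‖w₂‖ - 1| ≤ 2 * κ ^ 2 := by
    have hin : -ξ = ⟪-v, e⟫_ℝ := by rw [inner_neg_left]
    rw [hw₂, hin]
    refine wedge_velocity (ε := ε) he hκ0 (by linarith) (by linarith) hR
      (by rw [norm_neg]; exact hv.le) ?_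
    have : b - m₂ - (-v + R • e) = (b - (x + R • e)) - (m₂ - (x + v)) := by module
    rw [this]
    refine (norm_sub_le _ _).trans ?_
    linarith
  have hκsq : 2 * κ ^ 2 ≤ 1 / 4 := by
    have : κ ^ 2 ≤ (1 / 30000) ^ 2 := by gcongr
    linarith
  have hw1n : ‖w₁‖ ≤ 3 / 2 := by linarith [(abs_le.1 hw1b).2]
  have hw2n : ‖w₂‖ ≤ 3 / 2 := by linarith [(abs_le.1 hw2b).2]
  set γ₁ : ℝ → H := fun s => p + (s + R) • w₁ with hγ₁
  set γ₂ : ℝ → H := fun s => b + (s + -R) • w₂ with hγ₂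
  have hγ1ξ : γ₁ ξ = m₁ := by
    simp only [hγ₁, hw₁, smul_smul]
    rw [add_comm ξ R, mul_inv_cancel₀ hR1.ne', one_smul]; abel
  have hγ2ξ : γ₂ ξ = m₂ := by
    simp only [hγ₂, hw₂, smul_smul]
    have : (ξ + -R) * (R + -ξ)⁻¹ = -1 := by
      rw [← div_eq_mul_inv, div_eq_iff hR2.ne']; ring
    rw [this]; module
  have hjump : |F (γ₁ ξ) - F (γ₂ ξ)| ≤ 4 * ε * R := by
    rw [hγ1ξ, hγ2ξ]
    refine (abs_sub_le_of_lipschitz_two hF _ _).trans ?_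
    have : m₁ - m₂ = (m₁ - (x + v)) - (m₂ - (x + v)) := by abel
    rw [this]
    have := norm_sub_le (m₁ - (x + v)) (m₂ - (x + v))
    linarith
  have hjumpn : ‖γ₁ ξ - γ₂ ξ‖ ≤ 2 * ε * R := by
    rw [hγ1ξ, hγ2ξ]
    have : m₁ - m₂ = (m₁ - (x + v)) - (m₂ - (x + v)) := by abel
    rw [this]
    have := norm_sub_le (m₁ - (x + v)) (m₂ - (x + v))
    linarith
  set h₁ : ℝ → ℝ := fun s => F (p + (s + R) • w₁) - c * s with hh₁
  set h₂ : ℝ → ℝ := fun s => F (b + (s + -R) • w₂) - c * s with hh₂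
  have hL1 : LipschitzWith 5 h₁ := lipschitzWith_affine_sub_linear hF hc hw1n
  have hL2 : LipschitzWith 5 h₂ := lipschitzWith_affine_sub_linear hF hc hw2n
  -- `h` follows `h₁` up to `ξ` and `h₂` afterwards, without the jump at the vertex.
  set h : ℝ → ℝ := fun s => h₁ (min s ξ) + h₂ (max s ξ) with hh
  have hL : LipschitzWith 10 h := by
    have := (hL1.comp (LipschitzWith.id.min_const ξ)).add (hL2.comp (LipschitzWith.id.max_const ξ))
    simp only [mul_one] at this
    norm_num at this
    exact this
  have hle : ∀ s, s ≤ ξ → h s = h₁ s + h₂ ξ := fun s hs => by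
    simp only [hh, min_eq_left hs, max_eq_right hs]
  have hge : ∀ s, ξ ≤ s → h s = h₁ ξ + h₂ s := fun s hs => by
    simp only [hh, min_eq_right hs, max_eq_left hs]
  have hRR : |R| ≤ 5 / κ * R := by
    rw [abs_of_pos hR]
    have : 1 ≤ 5 / κ := by rw [le_div_iff₀ hκ0]; linarith
    exact le_mul_of_one_le_left hR.le this
  have hendL : |h₁ (-R) - F x| ≤ 3 * ε * R := by
    have e1 : h₁ (-R) - F x = (F p - F (x - R • e)) + (F (x + (-R) • e) - F x - c * (-R)) := by
      simp only [hh₁, neg_add_cancel, zero_smul, add_zero, neg_smul, ← sub_eq_add_neg]; ring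
    rw [e1]
    have h1 := abs_sub_le_of_lipschitz_two hF p (x - R • e)
    have h2 := hline (-R) (by rwa [abs_neg])
    rw [abs_neg, abs_of_pos hR] at h2
    refine (abs_add_le _ _).trans ?_
    linarith
  have hendR : |h₂ R - F x| ≤ 3 * ε * R := by
    have e1 : h₂ R - F x = (F b - F (x + R • e)) + (F (x + R • e) - F x - c * R) := by
      simp only [hh₂, add_neg_cancel, zero_smul, add_zero]; ring
    rw [e1]
    have h1 := abs_sub_le_of_lipschitz_two hF b (x + R • e)
    have h2 := hline R hRR
    rw [abs_of_pos hR] at h2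
    refine (abs_add_le _ _).trans ?_
    linarith
  have hξI : ξ ∈ Set.Icc (-R) R := ⟨by linarith, by linarith⟩
  set P := η * κ * R / 4 with hP
  have hηκR : 0 < η * κ * R := by positivity
  have hεηR : 128000 * (ε * R) ≤ η * κ * R := by
    have := mul_le_mul_of_nonneg_right hεη hR.le
    linarith
  have hup : 2 * P ≤ |h ξ - h (-R)| := by
    rw [hle ξ le_rfl, hle (-R) hξI.1]
    have e1 : F (x + v) - F x - c * ξ = (h₁ ξ + h₂ ξ - (h₁ (-R) + h₂ ξ))
        - (F (γ₁ ξ) - F (x + v)) + (h₁ (-R) - F x) := by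
      simp only [hh₁, hγ₁]; ring
    rw [e1] at hbig
    have h1 := abs_sub_le_of_lipschitz_two hF m₁ (x + v)
    rw [← hγ1ξ] at h1 hm₁
    have h2 := hbig.trans ((abs_add_le _ _).trans (add_le_add_left (abs_sub _ _) _))
    rw [hv] at h2
    have h3 : η * (κ * R) = η * κ * R := by ring
    linarith
  have hnet : |h R - h (-R)| ≤ P := by
    rw [hge R hξI.2, hle (-R) hξI.1]
    have e1 : h₁ ξ + h₂ R - (h₁ (-R) + h₂ ξ) = (F (γ₁ ξ) - F (γ₂ ξ)) + (h₂ R - F x)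
        - (h₁ (-R) - F x) := by
      simp only [hh₁, hh₂, hγ₁, hγ₂]; ring
    rw [e1]
    refine (abs_sub _ _).trans ((add_le_add_left (abs_add_le _ _) _).trans ?_)
    linarith
  -- Parameters close to the ends or to the vertex are excluded.
  set X : Set ℝ := Set.Icc (-R) (-R + θ * R) ∪ Set.Icc (ξ - θ * R) (ξ + θ * R)
    ∪ Set.Icc (R - θ * R) R with hX
  have hXv : ((10 : ℝ≥0) : ℝ≥0∞) * volume X ≤ ENNReal.ofReal (P / 8) := by
    have h0 : 0 < θ * R := by positivity
    have h1 : volume X ≤ ENNReal.ofReal (4 * (θ * R)) := by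
      refine (measure_union_le _ _).trans ((add_le_add_left (measure_union_le _ _) _).trans ?_)
      rw [Real.volume_Icc, Real.volume_Icc, Real.volume_Icc,
        ← ENNReal.ofReal_add (by linarith) (by linarith),
        ← ENNReal.ofReal_add (by linarith) (by linarith)]
      apply ENNReal.ofReal_le_ofReal
      linarith
    have h2 : ((10 : ℝ≥0) : ℝ≥0∞) = ENNReal.ofReal 10 := by norm_num
    rw [h2]
    refine (mul_le_mul_right h1 _).trans ?_
    rw [← ENNReal.ofReal_mul (by norm_num)]
    apply ENNReal.ofReal_le_ofReal
    have h3 : 1280 * (θ * R) = η * κ * R := by rw [← mul_assoc, hθ]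
    linarith
  obtain ⟨τ, hτI, hτX, hτD, hτinc⟩ := exists_deriv_ge_and_increment_le hL (by linarith)
    (by positivity) hξI hup hnet (X := X)
    ((measurableSet_Icc.union measurableSet_Icc).union measurableSet_Icc) hXv
  set D := deriv h τ with hD
  have hDlow : η * κ / 64 ≤ D := by
    refine le_trans (le_of_eq ?_) hτD
    rw [hP]; field_simp; ring
  have hD0 : 0 < D := lt_of_lt_of_le (by positivity) hDlow
  have hder : HasDerivAt h D τ := by
    refine DifferentiableAt.hasDerivAt ?_
    by_contra hnd
    rw [hD, deriv_zero_of_not_differentiableAt hnd] at hD0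
    exact lt_irrefl _ hD0
  have hDκ : 450 * κ ^ 2 ≤ D := by
    refine le_trans ?_ hDlow
    rw [← hκ, sq]
    have := mul_self_nonneg κ
    linarith
  simp only [hX, Set.mem_union, Set.mem_Icc, not_or, not_and, not_le] at hτX
  obtain ⟨⟨hτl, hτm⟩, hτr⟩ := hτX
  have hτl' : -R + θ * R < τ := hτl hτI.1
  have hτr' : τ < R - θ * R := by
    by_contra hcon
    push Not at hcon
    exact absurd hτI.2 (not_le.2 (hτr hcon))
  have hτθ : θ * R ≤ R - |τ| := by
    have : |τ| ≤ R - θ * R := abs_le.2 ⟨by linarith, by linarith⟩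
    linarith
  set B := 240 * √(10 * D) with hB
  have hB0 : 0 ≤ B := by positivity
  -- `far` absorbs the jump between the two segments into increments of length at least `θ * R`.
  have far : ∀ u, θ * R ≤ |u| → 100 * (ε * R) ≤ κ * |u| := fun u hu => by
    calc 100 * (ε * R) = κ * (θ * R) := by rw [← mul_assoc, hε]; ring
      _ ≤ κ * |u| := by gcongr
  have hτinc' : ∀ u ∈ Set.Icc (-R) R, |h u - h τ| ≤ B * |u - τ| := by
    intro u hu
    have := hτinc u hu
    simpa [hB] using this
  obtain ⟨y, w, hy, hwder, hwn, hydev, hynear⟩ : ∃ y w : H,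
      y ∈ segment ℝ p m₁ ∪ segment ℝ m₂ b ∧ HasLineDerivAt ℝ F (c + D) y w ∧
      |‖w‖ - 1| ≤ 2 * κ ^ 2 ∧ ‖y - (x + τ • e)‖ ≤ ε * R + 4 * κ * (R - |τ|) ∧
      ∀ u ∈ Set.Icc (-R) R, |F (y + (u - τ) • e) - F y - c * (u - τ)| ≤ (B + 5 * κ) * |u - τ| := by
    rcases lt_or_ge τ ξ with hτξ | hτξ
    · have hgap : θ * R ≤ ξ - τ := by
        by_contra hcon
        push Not at hcon
        linarith [hτm (by linarith)]
      refine ⟨γ₁ τ, w₁, Or.inl ?_, ?_, hw1b, ?_, ?_⟩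
      · rw [segment_eq_image']
        refine ⟨(τ + R) * (R + ξ)⁻¹, ⟨?_, ?_⟩, ?_⟩
        · have : 0 ≤ τ + R := by linarith [hτI.1]
          positivity
        · rw [← div_eq_mul_inv, div_le_one hR1]; linarith
        · simp only [hγ₁, hw₁, smul_smul]
      · refine hasLineDerivAt_of_hasDerivAt_affine ?_
        have h1 : HasDerivAt (fun s => h s - h₂ ξ) D τ := hder.sub_const _
        refine h1.congr_of_eventuallyEq ?_
        filter_upwards [Iio_mem_nhds hτξ] with s hs
        rw [hle s (le_of_lt hs)]
        simp only [hh₁]; ring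
      · have e1 : γ₁ τ - (x + τ • e) = (p - (x - R • e)) + (τ + R) • (w₁ - e) := by
          simp only [hγ₁]; module
        rw [e1]
        refine (norm_add_le _ _).trans (add_le_add hp ?_)
        have h0 : 0 ≤ τ + R := by linarith [hτI.1]
        rw [norm_smul, Real.norm_of_nonneg h0]
        have h2 : τ + R ≤ 2 * (R - |τ|) := by
          rcases le_total 0 τ with h3 | h3
          · rw [abs_of_nonneg h3]; linarith
          · rw [abs_of_nonpos h3]; linarith
        calc (τ + R) * ‖w₁ - e‖ ≤ (2 * (R - |τ|)) * (2 * κ) :=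
              mul_le_mul h2 hw1a (norm_nonneg _) (h0.trans h2)
          _ = 4 * κ * (R - |τ|) := by ring
      · intro u hu
        have hinc := hτinc' u hu
        rcases le_total u ξ with huξ | huξ
        · have e1 : F (γ₁ τ + (u - τ) • e) - F (γ₁ τ) - c * (u - τ)
              = (F (γ₁ τ + (u - τ) • e) - F (γ₁ u)) + (h u - h τ) := by
            rw [hle u huξ, hle τ hτξ.le]; simp only [hh₁, hγ₁]; ring
          have e2 : γ₁ τ + (u - τ) • e - γ₁ u = (τ - u) • (w₁ - e) := by
            simp only [hγ₁]; module
          have h1 := abs_sub_le_of_lipschitz_two hF (γ₁ τ + (u - τ) • e) (γ₁ u)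
          rw [e2, norm_smul, Real.norm_eq_abs, abs_sub_comm τ u] at h1
          have h2 : |u - τ| * ‖w₁ - e‖ ≤ |u - τ| * (2 * κ) := by gcongr
          rw [e1]
          refine (abs_add_le _ _).trans ?_
          have := mul_nonneg hκ0.le (abs_nonneg (u - τ))
          linarith
        · have e1 : F (γ₁ τ + (u - τ) • e) - F (γ₁ τ) - c * (u - τ)
              = (F (γ₁ τ + (u - τ) • e) - F (γ₂ u)) + (h u - h τ) - (F (γ₁ ξ) - F (γ₂ ξ)) := by
            rw [hge u huξ, hle τ hτξ.le]; simp only [hh₁, hh₂, hγ₁, hγ₂]; ring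
          have e2 : γ₁ τ + (u - τ) • e - γ₂ u
              = (γ₁ ξ - γ₂ ξ) + (τ - ξ) • (w₁ - e) + (ξ - u) • (w₂ - e) := by
            simp only [hγ₁, hγ₂]; module
          have h1 := abs_sub_le_of_lipschitz_two hF (γ₁ τ + (u - τ) • e) (γ₂ u)
          rw [e2] at h1
          have h2 := (norm_add_le ((γ₁ ξ - γ₂ ξ) + (τ - ξ) • (w₁ - e)) ((ξ - u) • (w₂ - e))).trans
            (add_le_add_left (norm_add_le _ _) _)
          rw [norm_smul, norm_smul, Real.norm_eq_abs, Real.norm_eq_abs,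
            abs_of_nonpos (by linarith : τ - ξ ≤ 0), abs_of_nonpos (by linarith : ξ - u ≤ 0)] at h2
          have habs : |u - τ| = u - τ := abs_of_nonneg (by linarith)
          have h3 : -(τ - ξ) * ‖w₁ - e‖ ≤ (ξ - τ) * (2 * κ) := by
            rw [neg_sub]; gcongr
          have h4 : -(ξ - u) * ‖w₂ - e‖ ≤ (u - ξ) * (2 * κ) := by
            rw [neg_sub]; gcongr
          have h6 := mul_pos hε0 hR
          have h5 := far (u - τ) (by rw [habs]; linarith)
          rw [e1]
          refine (abs_sub _ _).trans ((add_le_add_left (abs_add_le _ _) _).trans ?_)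
          rw [habs] at h5 hinc ⊢
          linarith
    · have hgap : θ * R ≤ τ - ξ := by
        have h0 : 0 < θ * R := by positivity
        have := hτm (by linarith)
        linarith
      refine ⟨γ₂ τ, w₂, Or.inr ?_, ?_, hw2b, ?_, ?_⟩
      · rw [segment_symm, segment_eq_image']
        refine ⟨(R - τ) * (R + -ξ)⁻¹, ⟨?_, ?_⟩, ?_⟩
        · have : 0 ≤ R - τ := by linarith [hτI.2]
          positivity
        · rw [← div_eq_mul_inv, div_le_one hR2]; linarith
        · simp only [hγ₂, hw₂, smul_smul]; module
      · refine hasLineDerivAt_of_hasDerivAt_affine ?_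
        have h1 : HasDerivAt (fun s => h s - h₁ ξ) D τ := hder.sub_const _
        refine h1.congr_of_eventuallyEq ?_
        have h0 : 0 < θ * R := by positivity
        filter_upwards [Ioi_mem_nhds (show ξ < τ by linarith)] with s hs
        rw [hge s (le_of_lt hs)]
        simp only [hh₂]; ring
      · have e1 : γ₂ τ - (x + τ • e) = (b - (x + R • e)) + (τ - R) • (w₂ - e) := by
          simp only [hγ₂]; module
        rw [e1]
        refine (norm_add_le _ _).trans (add_le_add hb ?_)
        have h0 : τ - R ≤ 0 := by linarith [hτI.2]
        rw [norm_smul, Real.norm_of_nonpos h0]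
        have h2 : -(τ - R) ≤ 2 * (R - |τ|) := by
          rcases le_total 0 τ with h3 | h3
          · rw [abs_of_nonneg h3]; linarith
          · rw [abs_of_nonpos h3]; linarith
        calc -(τ - R) * ‖w₂ - e‖ ≤ (2 * (R - |τ|)) * (2 * κ) :=
              mul_le_mul h2 hw2a (norm_nonneg _) (by linarith)
          _ = 4 * κ * (R - |τ|) := by ring
      · intro u hu
        have hinc := hτinc' u hu
        rcases le_total ξ u with huξ | huξ
        · have e1 : F (γ₂ τ + (u - τ) • e) - F (γ₂ τ) - c * (u - τ)
              = (F (γ₂ τ + (u - τ) • e) - F (γ₂ u)) + (h u - h τ) := by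
            rw [hge u huξ, hge τ hτξ]; simp only [hh₂, hγ₂]; ring
          have e2 : γ₂ τ + (u - τ) • e - γ₂ u = (τ - u) • (w₂ - e) := by
            simp only [hγ₂]; module
          have h1 := abs_sub_le_of_lipschitz_two hF (γ₂ τ + (u - τ) • e) (γ₂ u)
          rw [e2, norm_smul, Real.norm_eq_abs, abs_sub_comm τ u] at h1
          have h2 : |u - τ| * ‖w₂ - e‖ ≤ |u - τ| * (2 * κ) := by gcongr
          rw [e1]
          refine (abs_add_le _ _).trans ?_
          have := mul_nonneg hκ0.le (abs_nonneg (u - τ))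
          linarith
        · have e1 : F (γ₂ τ + (u - τ) • e) - F (γ₂ τ) - c * (u - τ)
              = (F (γ₂ τ + (u - τ) • e) - F (γ₁ u)) + (h u - h τ) + (F (γ₁ ξ) - F (γ₂ ξ)) := by
            rw [hle u huξ, hge τ hτξ]; simp only [hh₁, hh₂, hγ₁, hγ₂]; ring
          have e2 : γ₂ τ + (u - τ) • e - γ₁ u
              = -(γ₁ ξ - γ₂ ξ) + (τ - ξ) • (w₂ - e) + (ξ - u) • (w₁ - e) := by
            simp only [hγ₁, hγ₂]; module
          have h1 := abs_sub_le_of_lipschitz_two hF (γ₂ τ + (u - τ) • e) (γ₁ u)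
          rw [e2] at h1
          have h2 := (norm_add_le (-(γ₁ ξ - γ₂ ξ) + (τ - ξ) • (w₂ - e))
            ((ξ - u) • (w₁ - e))).trans (add_le_add_left (norm_add_le _ _) _)
          rw [norm_neg, norm_smul, norm_smul, Real.norm_eq_abs, Real.norm_eq_abs,
            abs_of_nonneg (by linarith : 0 ≤ τ - ξ), abs_of_nonneg (by linarith : 0 ≤ ξ - u)] at h2
          have habs : |u - τ| = τ - u := by rw [abs_of_nonpos (by linarith)]; ring
          have h3 : (τ - ξ) * ‖w₂ - e‖ ≤ (τ - ξ) * (2 * κ) := by gcongr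
          have h4 : (ξ - u) * ‖w₁ - e‖ ≤ (ξ - u) * (2 * κ) := by gcongr
          have h6 := mul_pos hε0 hR
          have h5 := far (u - τ) (by rw [habs]; linarith)
          rw [e1]
          refine (abs_add_le _ _).trans ((add_le_add_left (abs_add_le _ _) _).trans ?_)
          rw [habs] at h5 hinc ⊢
          linarith
  obtain ⟨e', c', he', hc'der, hcc'⟩ := exists_unit_direction hF (by linarith) hκ0
    (by linarith [sq_nonneg κ]) hwder hwn
  refine ⟨y, hy, ?_, e', c', he', hc'der, by linarith, fun t => ?_⟩
  · have e1 : y - x = (y - (x + τ • e)) + τ • e := by abel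
    rw [e1]
    refine (norm_add_le _ _).trans ?_
    rw [norm_smul, he, Real.norm_eq_abs]
    have h0 : |τ| ≤ R := by have : 0 < θ * R := by positivity
                            linarith
    have h1 : 4 * κ * (R - |τ|) ≤ 1 * (R - |τ|) :=
      mul_le_mul_of_nonneg_right (by linarith) (by linarith)
    have h2 : ε * R ≤ 1 * R := mul_le_mul_of_nonneg_right (by linarith) hR.le
    linarith
  · have h1 := increment_le_of_near_line hF he hκ0 (by linarith) hθ0 (by linarith) hε hR
      (by positivity : 0 ≤ B + 5 * κ) hline hτθ hydev hynear t
    refine h1.trans ?_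
    gcongr
    -- `√(10 * D) ≤ √20 * √(c' - c)` and `24 * κ ≤ 2 * √(c' - c)`.
    have h2 : √(10 * D) ≤ 9 / 2 * √(c' - c) := by
      rw [Real.sqrt_le_left (by positivity), mul_pow, Real.sq_sqrt (by linarith)]
      linarith
    have h3 : κ ≤ √(c' - c) := by
      apply Real.le_sqrt_of_sq_le
      linarith [sq_nonneg κ]
    linarith

/-- If `F` has a derivative `c` in the direction `e` at `x` but is not Fréchet differentiable
there, then every set in which short segments near `x` can be approximated contains, arbitrarily
close to `x`, points with a directional derivative exceeding `c` by a fixed amount, and with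
increments in the direction `e` close to those at `x`. -/
theorem exists_improved_direction {F : H → ℝ} (hF : LipschitzWith 2 F) {x e : H} {c : ℝ}
    (he : ‖e‖ = 1) (hder : HasLineDerivAt ℝ F c x e) (hnd : ¬ DifferentiableAt ℝ F x) :
    ∃ g > 0, ∀ M : Set H, ApproximableAt M x → ∀ ρ > 0, ∃ y ∈ M, ‖y - x‖ < ρ ∧
      ∃ e' : H, ∃ c' : ℝ, ‖e'‖ = 1 ∧ HasLineDerivAt ℝ F c' y e' ∧ c + g ≤ c' ∧
        ∀ t : ℝ, |F (y + t • e) - F y - (F (x + t • e) - F x)| ≤ 1200 * √(c' - c) * |t| := by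
  have hc : |c| ≤ 2 := by
    have := hder.le_of_lipschitz hF
    rw [he] at this
    simpa using this
  have hnf : ¬ HasFDerivAt F (c • innerSL ℝ e) x := fun h => hnd h.differentiableAt
  rw [hasFDerivAt_iff_isLittleO_nhds_zero, Asymptotics.isLittleO_iff] at hnf
  push Not at hnf
  obtain ⟨C, hC, hfreq⟩ := hnf
  set η := min C 1 with hη
  have hη0 : 0 < η := lt_min hC one_pos
  set κ := η / 30000 with hκ
  set θ := η * κ / 1280 with hθ
  set ε := κ * θ / 100 with hε
  have hκ0 : 0 < κ := by positivity
  have hκ1 : κ ≤ 1 := by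
    have : η ≤ 1 := min_le_right _ _
    rw [hκ]; linarith
  have hε0 : 0 < ε := by positivity
  refine ⟨η * κ / 128, by positivity, fun M hM ρ hρ => ?_⟩
  obtain ⟨δ₀, hδ₀, happ⟩ := hM ε hε0
  rw [hasLineDerivAt_iff_isLittleO_nhds_zero, Asymptotics.isLittleO_iff] at hder
  obtain ⟨ρ₁, hρ₁, hline⟩ := Metric.eventually_nhds_iff.1 (hder hε0)
  set r := min (min δ₀ (ρ / 2)) (κ * ρ₁ / 5) with hr
  have hr0 : 0 < r := by positivity
  obtain ⟨v, hvbig, hvr⟩ := (hfreq.and_eventually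
    (Metric.ball_mem_nhds (0 : H) (by positivity : 0 < κ * r))).exists
  rw [dist_zero_right] at hvr
  set R := ‖v‖ / κ with hR
  have hv0 : 0 < ‖v‖ := by
    rw [norm_pos_iff]
    rintro rfl
    simp at hvbig
  have hR0 : 0 < R := by positivity
  have hRr : R < r := by rw [hR, div_lt_iff₀ hκ0]; linarith
  have hvR : ‖v‖ = κ * R := by rw [hR]; field_simp
  have hR1 : R < δ₀ := hRr.trans_le ((min_le_left _ _).trans (min_le_left _ _))
  have hR2 : R < ρ / 2 := hRr.trans_le ((min_le_left _ _).trans (min_le_right _ _))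
  have hR3 : R < κ * ρ₁ / 5 := hRr.trans_le (min_le_right _ _)
  have hnRe : ‖R • e‖ = R := by rw [norm_smul, he, Real.norm_of_nonneg hR0.le, mul_one]
  have hvle : ‖x + v - x‖ ≤ R := by
    rw [add_sub_cancel_left, hvR]
    exact mul_le_of_le_one_left hR0.le hκ1
  obtain ⟨p, m₁, hp, hm₁, hs₁⟩ := happ R hR0 hR1 (x - R • e) (x + v)
    (by rw [sub_sub_cancel_left, norm_neg, hnRe]) hvle
  obtain ⟨m₂, b, hm₂, hb, hs₂⟩ := happ R hR0 hR1 (x + v) (x + R • e) hvle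
    (by rw [add_sub_cancel_left, hnRe])
  have hline' : ∀ u, |u| ≤ 5 / κ * R → |F (x + u • e) - F x - c * u| ≤ ε * |u| := by
    intro u hu
    have h1 : dist u 0 < ρ₁ := by
      rw [dist_zero_right, Real.norm_eq_abs]
      refine hu.trans_lt ?_
      rw [div_mul_eq_mul_div, div_lt_iff₀ hκ0]
      linarith
    have h2 := hline h1
    rwa [Real.norm_eq_abs, Real.norm_eq_abs, smul_eq_mul, mul_comm u c] at h2
  have hbig : η * ‖v‖ ≤ |F (x + v) - F x - c * ⟪v, e⟫_ℝ| := by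
    have h1 : η * ‖v‖ ≤ C * ‖v‖ := by gcongr; exact min_le_left _ _
    refine h1.trans (hvbig.le.trans (le_of_eq ?_))
    rw [Real.norm_eq_abs, real_inner_comm]
    simp
  obtain ⟨y, hy, hyx, e', c', he', hc', hcc', hinc⟩ := exists_improved_direction_on_wedge
    (κ := κ) (θ := θ) (ε := ε) hF he hc
    hη0 (min_le_right _ _) (by rw [hκ]; ring) (by rw [hθ]; ring) (by rw [hε]; ring) hR0 hline' hvR
    hbig hp hm₁ hm₂ hb
  exact ⟨y, hy.elim (fun h => hs₁ h) (fun h => hs₂ h), by linarith, e', c', he', hc', hcc', hinc⟩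

end Wedge

/-! ### Almost maximal directional derivatives -/

theorem abs_sub_le_of_lipschitz_one {H : Type*} [NormedAddCommGroup H] {f : H → ℝ}
    (hf : LipschitzWith 1 f) (y z : H) : |f y - f z| ≤ ‖y - z‖ := by
  have := hf.dist_le_mul y z
  rwa [Real.dist_eq, dist_eq_norm, NNReal.coe_one, one_mul] at this

theorem cauchySeq_of_norm_sub_le {E : Type*} [NormedAddCommGroup E] {z : ℕ → E} {b : ℕ → ℝ}
    (hz : ∀ n m, n ≤ m → ‖z m - z n‖ ≤ b n) (hb : Tendsto b atTop (𝓝 0)) : CauchySeq z := by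
  refine cauchySeq_of_le_tendsto_0' b (fun n m hnm => ?_) hb
  rw [dist_comm, dist_eq_norm]
  exact hz n m hnm

section Maximal

variable {H : Type*} [NormedAddCommGroup H] [InnerProductSpace ℝ H]

open scoped InnerProductSpace

/-- The increments of `f` from `x` and from `x'` in the direction `e` differ by at most `B` times
the length of the step. -/
def IncrementLE (f : H → ℝ) (x x' e : H) (B : ℝ) : Prop :=
  ∀ t : ℝ, |f (x' + t • e) - f x' - (f (x + t • e) - f x)| ≤ B * |t|

/-- The directional derivative at `p.1` in the direction `p.2` of the perturbation of `f` by the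
linear functional `⟪ℓ, ·⟫`. -/
noncomputable def perturbedDeriv (f : H → ℝ) (ℓ : H) (p : H × H) : ℝ :=
  lineDeriv ℝ f p.1 p.2 + ⟪ℓ, p.2⟫_ℝ

/-- Pairs of a point and a unit direction in which `f` has a directional derivative. -/
def DirectedPair (f : H → ℝ) (p : H × H) : Prop :=
  ‖p.2‖ = 1 ∧ LineDifferentiableAt ℝ f p.1 p.2

theorem IncrementLE.mono {f : H → ℝ} {x x' e : H} {B B' : ℝ} (h : IncrementLE f x x' e B)
    (hB : B ≤ B') : IncrementLE f x x' e B' := fun t =>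
  (h t).trans (by gcongr)

theorem exists_forall_abs_sub_le_of_hasLineDerivAt {f : H → ℝ} {x e : H} {a : ℝ}
    (h : HasLineDerivAt ℝ f a x e) {β : ℝ} (hβ : 0 < β) :
    ∃ Δ > 0, ∀ t : ℝ, |t| < Δ → |f (x + t • e) - f x - a * t| ≤ β * |t| := by
  rw [hasLineDerivAt_iff_isLittleO_nhds_zero, Asymptotics.isLittleO_iff] at h
  obtain ⟨Δ, hΔ, hh⟩ := Metric.eventually_nhds_iff.1 (h hβ)
  refine ⟨Δ, hΔ, fun t ht => ?_⟩
  have := hh (y := t) (by rwa [dist_zero_right, Real.norm_eq_abs])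
  rwa [Real.norm_eq_abs, Real.norm_eq_abs, smul_eq_mul, mul_comm t a] at this

/-- Increment bounds compose without loss: if `(y, u)` satisfies a strict increment bound with
respect to `(x, e)`, and the two directions and derivatives are close, then points near `y` with a
small increment bound with respect to `(y, u)` still satisfy the bound with respect to `(x, e)`.
Short increments are compared through the derivatives, long ones through the distance to `y`. -/
theorem IncrementLE.trans {f : H → ℝ} (hf : LipschitzWith 1 f) {x e y u : H} {a b σ σ' ε β W : ℝ}
    (ha : HasLineDerivAt ℝ f a x e) (hb : HasLineDerivAt ℝ f b y u) (hε : 0 < ε) (hβ : 0 < β)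
    (hsum : |b - a| + ‖u - e‖ + σ' + β ≤ σ) (hI : IncrementLE f x y e (σ - ε + W)) :
    ∃ δ > 0, ∃ ε' > 0, ∀ x' : H, ‖x' - y‖ ≤ δ → ∀ V V' : ℝ, W ≤ V' → V ≤ V' →
      IncrementLE f y x' u (σ' + V) → IncrementLE f x x' e (σ - ε' + V') := by
  obtain ⟨Δ₁, hΔ₁, h1⟩ := exists_forall_abs_sub_le_of_hasLineDerivAt ha (by positivity : 0 < β / 4)
  obtain ⟨Δ₂, hΔ₂, h2⟩ := exists_forall_abs_sub_le_of_hasLineDerivAt hb (by positivity : 0 < β / 4)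
  set Δ := min Δ₁ Δ₂ with hΔ
  have hΔ0 : 0 < Δ := lt_min hΔ₁ hΔ₂
  refine ⟨ε * Δ / 4, by positivity, min (ε / 2) (β / 2), by positivity, ?_⟩
  intro x' hx' V V' hWV hVV hinc t
  rcases lt_or_ge |t| Δ with ht | ht
  · have e1 := h1 t (ht.trans_le (min_le_left _ _))
    have e2 := h2 t (ht.trans_le (min_le_right _ _))
    have e3 := hinc t
    have e4 := abs_sub_le_of_lipschitz_one hf (x' + t • e) (x' + t • u)
    have e5 : x' + t • e - (x' + t • u) = t • (e - u) := by module
    rw [e5, norm_smul, Real.norm_eq_abs, norm_sub_rev] at e4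
    have e6 : f (x' + t • e) - f x' - (f (x + t • e) - f x)
        = (f (x' + t • e) - f (x' + t • u)) + (f (x' + t • u) - f x' - (f (y + t • u) - f y))
          + (f (y + t • u) - f y - b * t) - (f (x + t • e) - f x - a * t) + (b - a) * t := by ring
    have e7 : |(b - a) * t| = |b - a| * |t| := abs_mul _ _
    have e8 : |t| * ‖u - e‖ + (σ' + V) * |t| + β / 4 * |t| + β / 4 * |t| + |b - a| * |t|
        = (|b - a| + ‖u - e‖ + σ' + β - β / 2 + V) * |t| := by ring
    have e9 : (|b - a| + ‖u - e‖ + σ' + β - β / 2 + V) * |t|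
        ≤ (σ - min (ε / 2) (β / 2) + V') * |t| := by
      gcongr
      have := min_le_right (ε / 2) (β / 2)
      linarith
    rw [e6]
    refine le_trans ?_ (e8.le.trans e9)
    refine (abs_add_le _ _).trans (add_le_add ((abs_sub _ _).trans (add_le_add
      ((abs_add_le _ _).trans (add_le_add ((abs_add_le _ _).trans (add_le_add e4 e3)) e2)) e1))
      e7.le)
  · have e1 := hI t
    have e2 := abs_sub_le_of_lipschitz_one hf (x' + t • e) (y + t • e)
    have e3 := abs_sub_le_of_lipschitz_one hf x' y
    rw [add_sub_add_right_eq_sub] at e2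
    have e4 : f (x' + t • e) - f x' - (f (x + t • e) - f x)
        = (f (x' + t • e) - f (y + t • e)) - (f x' - f y)
          + (f (y + t • e) - f y - (f (x + t • e) - f x)) := by ring
    have e5 : ε * Δ ≤ ε * |t| := by gcongr
    have e6 : (σ - ε / 2 + W) * |t| ≤ (σ - min (ε / 2) (β / 2) + V') * |t| := by
      gcongr
      exact min_le_left _ _
    rw [e4]
    refine le_trans ((abs_add_le _ _).trans (add_le_add_left (abs_sub _ _) _)) ?_
    linarith

theorem abs_perturbedDeriv_le {f : H → ℝ} (hf : LipschitzWith 1 f) {ℓ : H} {p : H × H}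
    (hp : ‖p.2‖ = 1) : |perturbedDeriv f ℓ p| ≤ 1 + ‖ℓ‖ := by
  have h1 : ‖lineDeriv ℝ f p.1 p.2‖ ≤ 1 := by
    have := norm_lineDeriv_le_of_lipschitz ℝ (x₀ := p.1) (v := p.2) hf
    rwa [hp, NNReal.coe_one, mul_one] at this
  have h2 : |⟪ℓ, p.2⟫_ℝ| ≤ ‖ℓ‖ := by
    have := abs_real_inner_le_norm ℓ p.2
    rwa [hp, mul_one] at this
  exact (abs_add_le _ _).trans (add_le_add h1 h2)

theorem exists_almost_maximum {α : Type*} {C : Set α} (hC : C.Nonempty) {G : α → ℝ} {B lam : ℝ}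
    (hlam : 0 < lam) (hB : ∀ q ∈ C, G q ≤ B) : ∃ p ∈ C, ∀ q ∈ C, G q ≤ G p + lam := by
  have hbdd : BddAbove (G '' C) := ⟨B, by rintro _ ⟨q, hq, rfl⟩; exact hB q hq⟩
  obtain ⟨_, ⟨p, hp, rfl⟩, hlt⟩ := exists_lt_of_lt_csSup (hC.image G)
    (show sSup (G '' C) - lam < sSup (G '' C) by linarith)
  refine ⟨p, hp, fun q hq => ?_⟩
  have := le_csSup hbdd (Set.mem_image_of_mem G hq)
  linarith

/-- The perturbation forces directions to converge: if the perturbed derivative with `⟪ℓ, ·⟫` is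
nearly maximal at `e`, and adding the multiple `t * ⟪e, ·⟫` makes it no smaller at `e'` than at
`e`, then `e'` is close to `e`, and so are the derivatives. -/
theorem direction_close {ℓ e e' : H} {a b t σ lam : ℝ} (he : ‖e‖ = 1) (he' : ‖e'‖ = 1)
    (hℓ : ‖ℓ‖ ≤ 1) (ht : 0 < t) (hσ : 0 ≤ σ) (hlam : 50 * lam ≤ t * σ ^ 2)
    (h1 : a + ⟪ℓ + t • e, e⟫_ℝ ≤ b + ⟪ℓ + t • e, e'⟫_ℝ)
    (h2 : b + ⟪ℓ, e'⟫_ℝ ≤ a + ⟪ℓ, e⟫_ℝ + lam) :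
    ‖e' - e‖ ≤ σ / 5 ∧ |b - a| ≤ lam + σ / 5 ∧
      b + ⟪ℓ + t • e, e'⟫_ℝ - (a + ⟪ℓ + t • e, e⟫_ℝ) ≤ lam := by
  have hee : ⟪e, e⟫_ℝ = 1 := by rw [real_inner_self_eq_norm_sq, he]; norm_num
  have hee' : ⟪e, e'⟫_ℝ ≤ 1 := by
    have := real_inner_le_norm e e'
    rwa [he, he', mul_one] at this
  simp only [inner_add_left, real_inner_smul_left, hee] at h1 ⊢
  have h3 : t * (1 - ⟪e, e'⟫_ℝ) ≤ lam := by linarith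
  have h3' : 0 ≤ t * (1 - ⟪e, e'⟫_ℝ) := mul_nonneg ht.le (by linarith)
  have h4 : 1 - ⟪e, e'⟫_ℝ ≤ σ ^ 2 / 50 := by
    have : t * (1 - ⟪e, e'⟫_ℝ) ≤ t * (σ ^ 2 / 50) := by linarith
    exact le_of_mul_le_mul_left this ht
  have h5 : ‖e' - e‖ ^ 2 ≤ (σ / 5) ^ 2 := by
    rw [norm_sub_sq_real, he, he', real_inner_comm]
    linarith
  have h6 : ‖e' - e‖ ≤ σ / 5 := (pow_le_pow_iff_left₀ (norm_nonneg _) (by positivity)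
    two_ne_zero).1 h5
  have h7 : |⟪ℓ, e'⟫_ℝ - ⟪ℓ, e⟫_ℝ| ≤ σ / 5 := by
    rw [← inner_sub_right]
    refine (abs_real_inner_le_norm _ _).trans ?_
    calc ‖ℓ‖ * ‖e' - e‖ ≤ 1 * (σ / 5) := by gcongr
      _ = σ / 5 := one_mul _
  have h8 := abs_le.1 h7
  refine ⟨h6, ?_, by linarith⟩
  rw [abs_le]
  constructor <;> linarith

/-- The data of one step of the maximisation: a point and a direction, the perturbing vector, an
upper bound for the admissible indices of the sets, and the radius within which the search
continues. -/
structure Stage (H : Type*) where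
  /-- the current point and direction -/
  p : H × H
  /-- the perturbing vector -/
  ℓ : H
  /-- the strict upper bound for the indices -/
  s : ℝ
  /-- the radius of the search -/
  δ : ℝ

/-- The size of the `n`-th perturbation. -/
noncomputable def pert (n : ℕ) : ℝ := (1 / 2) ^ (n + 1)

/-- The tolerance in the increment condition at step `n`. -/
noncomputable def tol (n : ℕ) : ℝ := (1 / 8) ^ n

/-- The accuracy of the maximisation at step `n`. The denominator exceeds `1200 ^ 2`, so that
`1200 * √(acc n) ≤ tol n`. -/
noncomputable def acc (n : ℕ) : ℝ := pert n * tol n ^ 2 / 2000000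

/-- The candidates for the pair following the stage `S`. -/
def Stage.next (f : H → ℝ) (M : ℝ → Set H) (n : ℕ) (S : Stage H) : Set (H × H) :=
  {q | DirectedPair f q ∧ (∃ u ∈ Set.Ico 0 S.s, q.1 ∈ M u) ∧ ‖q.1 - S.p.1‖ < S.δ ∧
    perturbedDeriv f (S.ℓ + pert n • S.p.2) S.p ≤ perturbedDeriv f (S.ℓ + pert n • S.p.2) q ∧
    ∃ ε > 0, IncrementLE f S.p.1 q.1 S.p.2 (tol n - ε +
      1200 * √(perturbedDeriv f (S.ℓ + pert n • S.p.2) q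
        - perturbedDeriv f (S.ℓ + pert n • S.p.2) S.p))}

/-- The invariant of the maximisation: the pair of the stage is almost maximal among the
candidates for the following pair. -/
structure Stage.Valid (f : H → ℝ) (M : ℝ → Set H) (n : ℕ) (S : Stage H) : Prop where
  pair : DirectedPair f S.p
  norm_le : ‖S.ℓ‖ ≤ 1 - (1 / 2) ^ n
  mem : ∃ u ∈ Set.Ico 0 S.s, S.p.1 ∈ M u
  pos : 0 < S.δ
  max : ∀ q ∈ S.next f M n, perturbedDeriv f S.ℓ q ≤ perturbedDeriv f S.ℓ S.p + acc n

/-- The relation between consecutive stages. The increment bound `incr` is the form in which the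
increment conditions of consecutive stages compose; it is applied to candidates of later stages and
to points near the limit. -/
structure Stage.Step (f : H → ℝ) (M : ℝ → Set H) (n : ℕ) (S S' : Stage H) : Prop where
  mem_next : S'.p ∈ S.next f M n
  subset : S'.next f M (n + 1) ⊆ S.next f M n
  pert_eq : S'.ℓ = S.ℓ + pert n • S.p.2
  lt : S'.s < S.s
  half : S'.δ ≤ S.δ / 2
  room : ‖S'.p.1 - S.p.1‖ + 2 * S'.δ ≤ S.δ
  incr : ∃ ε > 0, ∀ z : H, ‖z - S'.p.1‖ ≤ S'.δ → ∀ b B : ℝ,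
    perturbedDeriv f S'.ℓ S'.p - perturbedDeriv f S'.ℓ S.p ≤ B → b ≤ B →
    IncrementLE f S'.p.1 z S'.p.2 (3 * tol (n + 1) + 1200 * √b) →
    IncrementLE f S.p.1 z S.p.2 (tol n - ε + 1200 * √B)

theorem pert_pos (n : ℕ) : 0 < pert n := by unfold pert; positivity

theorem tol_pos (n : ℕ) : 0 < tol n := by unfold tol; positivity

theorem acc_pos (n : ℕ) : 0 < acc n := by
  have := pert_pos n
  have := tol_pos n
  unfold acc; positivity

theorem pert_le_one (n : ℕ) : pert n ≤ 1 := pow_le_one₀ (by norm_num) (by norm_num)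

theorem tol_le_one (n : ℕ) : tol n ≤ 1 := pow_le_one₀ (by norm_num) (by norm_num)

theorem tol_succ (n : ℕ) : tol (n + 1) = tol n / 8 := by unfold tol; rw [pow_succ]; ring

theorem fifty_mul_acc_le (n : ℕ) : 50 * acc n ≤ pert n * tol n ^ 2 := by
  have h1 := pert_pos n
  have h2 := tol_pos n
  have : 0 < pert n * tol n ^ 2 := by positivity
  unfold acc; linarith

theorem acc_le_tol (n : ℕ) : acc n ≤ tol n / 50 := by
  have h1 := pert_le_one n
  have h2 := tol_le_one n
  have h3 := tol_pos n
  have h5 : pert n * tol n ^ 2 ≤ 1 * (tol n * 1) := by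
    rw [sq]; gcongr
  have := fifty_mul_acc_le n
  linarith

theorem sqrt_acc_le (n : ℕ) : 1200 * √(acc n) ≤ tol n := by
  have h1 := tol_pos n
  have h2 : √(acc n) ≤ tol n / 1200 := by
    rw [Real.sqrt_le_left (by positivity)]
    have h3 : pert n * tol n ^ 2 ≤ 1 * tol n ^ 2 := by gcongr; exact pert_le_one n
    have h4 : 0 < tol n ^ 2 := by positivity
    unfold acc
    rw [div_pow]
    linarith
  linarith

theorem tendsto_tol : Tendsto tol atTop (𝓝 0) :=
  tendsto_pow_atTop_nhds_zero_of_lt_one (by norm_num) (by norm_num)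

theorem Stage.Valid.norm_le_one {f : H → ℝ} {M : ℝ → Set H} {n : ℕ} {S : Stage H}
    (hS : S.Valid f M n) : ‖S.ℓ‖ ≤ 1 := by
  have := hS.norm_le
  have : (0 : ℝ) < (1 / 2) ^ n := by positivity
  linarith

/-- Candidates for the next pair are close to the current pair in direction and derivative. -/
theorem Stage.Valid.close {f : H → ℝ} {M : ℝ → Set H} {n : ℕ} {S : Stage H} (hS : S.Valid f M n)
    {q : H × H} (hq : q ∈ S.next f M n) :
    ‖q.2 - S.p.2‖ ≤ tol n / 5 ∧
    |lineDeriv ℝ f q.1 q.2 - lineDeriv ℝ f S.p.1 S.p.2| ≤ acc n + tol n / 5 ∧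
    perturbedDeriv f (S.ℓ + pert n • S.p.2) q - perturbedDeriv f (S.ℓ + pert n • S.p.2) S.p
      ≤ acc n :=
  direction_close hS.pair.1 hq.1.1 hS.norm_le_one (pert_pos n) (tol_pos n).le
    (fifty_mul_acc_le n) hq.2.2.2.1 (hS.max q hq)

/-- A valid stage is followed by another: the perturbation is increased in the current direction,
and the next pair is almost maximal among the candidates. Every candidate for the pair after the
next is a candidate for the next, because the increment conditions compose. -/
theorem Stage.Valid.exists_step {f : H → ℝ} (hf : LipschitzWith 1 f) {M : ℝ → Set H} {n : ℕ}
    {S : Stage H} (hS : S.Valid f M n) :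
    ∃ S' : Stage H, S'.Valid f M (n + 1) ∧ S.Step f M n S' := by
  set ℓ' := S.ℓ + pert n • S.p.2 with hℓ'
  have hσ0 := tol_pos n
  have hself : S.p ∈ S.next f M n := by
    refine ⟨hS.pair, hS.mem, by simpa using hS.pos, le_rfl, tol n, tol_pos n, fun t => ?_⟩
    simp
  have hℓn : ‖ℓ'‖ ≤ 1 - (1 / 2) ^ (n + 1) := by
    refine (norm_add_le _ _).trans ?_
    rw [norm_smul, hS.pair.1, Real.norm_of_nonneg (pert_pos n).le]
    have h1 := hS.norm_le
    have h2 : (1 / 2 : ℝ) ^ n = 2 * (1 / 2) ^ (n + 1) := by rw [pow_succ]; ring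
    unfold pert
    linarith
  obtain ⟨p', hp', hmax⟩ := exists_almost_maximum ⟨S.p, hself⟩ (G := perturbedDeriv f ℓ')
    (acc_pos (n + 1))
    (fun q hq => (le_abs_self _).trans (abs_perturbedDeriv_le hf hq.1.1))
  obtain ⟨hc1, hc2, -⟩ := hS.close hp'
  obtain ⟨hpair, ⟨u, hu, hpu⟩, hδ, hG, ε, hε, hinc⟩ := hp'
  obtain ⟨δ₁, hδ₁, ε', hε', htr⟩ := IncrementLE.trans hf hS.pair.2.hasLineDerivAt
    hpair.2.hasLineDerivAt (σ' := 3 * tol (n + 1)) (β := tol n / 100) hε (by positivity) (by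
      have := acc_le_tol n
      rw [tol_succ]
      linarith) hinc
  set δ' := min δ₁ ((S.δ - ‖p'.1 - S.p.1‖) / 2) with hδ'
  have hδ'0 : 0 < δ' := lt_min hδ₁ (by linarith)
  have hroom : ‖p'.1 - S.p.1‖ + 2 * δ' ≤ S.δ := by
    have := min_le_right δ₁ ((S.δ - ‖p'.1 - S.p.1‖) / 2)
    linarith
  have hincr : ∀ z : H, ‖z - p'.1‖ ≤ δ' → ∀ b B : ℝ,
      perturbedDeriv f ℓ' p' - perturbedDeriv f ℓ' S.p ≤ B → b ≤ B →
      IncrementLE f p'.1 z p'.2 (3 * tol (n + 1) + 1200 * √b) →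
      IncrementLE f S.p.1 z S.p.2 (tol n - ε' + 1200 * √B) := by
    intro z hz b B h1 h2 h3
    refine htr z (hz.trans (min_le_left _ _)) (1200 * √b) _ ?_ ?_ h3
    · gcongr
    · gcongr
  set S' : Stage H := ⟨p', ℓ', (u + S.s) / 2, δ'⟩ with hS'
  have hsub : S'.next f M (n + 1) ⊆ S.next f M n := by
    rintro q ⟨hq1, ⟨v, hv, hqv⟩, hq3, hq4, ε₂, hε₂, hq5⟩
    have hlin : ∀ q : H × H, perturbedDeriv f (ℓ' + pert (n + 1) • p'.2) q
        = perturbedDeriv f ℓ' q + pert (n + 1) * ⟪p'.2, q.2⟫_ℝ := by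
      intro q
      simp only [perturbedDeriv, inner_add_left, real_inner_smul_left]; ring
    have hin : ⟪p'.2, q.2⟫_ℝ ≤ 1 := by
      have := real_inner_le_norm p'.2 q.2
      rwa [hpair.1, hq1.1, mul_one] at this
    have hinp : ⟪p'.2, p'.2⟫_ℝ = 1 := by
      rw [real_inner_self_eq_norm_sq, hpair.1]; norm_num
    have hle : pert (n + 1) * ⟪p'.2, q.2⟫_ℝ ≤ pert (n + 1) * 1 :=
      mul_le_mul_of_nonneg_left hin (pert_pos _).le
    simp only [hS', hlin, hinp] at hq3 hq4 hq5 hv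
    refine ⟨hq1, ⟨v, ⟨hv.1, by linarith [hv.2, hu.2]⟩, hqv⟩, ?_, by linarith, ε', hε', ?_⟩
    · have := norm_sub_le_norm_sub_add_norm_sub q.1 p'.1 S.p.1
      linarith
    · refine hincr q.1 hq3.le (perturbedDeriv f ℓ' q - perturbedDeriv f ℓ' p'
        + pert (n + 1) * ⟪p'.2, q.2⟫_ℝ - pert (n + 1) * 1) _ ?_ ?_ (hq5.mono ?_)
      · linarith
      · linarith
      · have h0 := tol_pos (n + 1)
        have h1 : perturbedDeriv f ℓ' q + pert (n + 1) * ⟪p'.2, q.2⟫_ℝ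
            - (perturbedDeriv f ℓ' p' + pert (n + 1) * 1)
            = perturbedDeriv f ℓ' q - perturbedDeriv f ℓ' p' + pert (n + 1) * ⟪p'.2, q.2⟫_ℝ
              - pert (n + 1) * 1 := by ring
        rw [h1]
        linarith
  refine ⟨S', ⟨hpair, hℓn, ⟨u, ⟨hu.1, ?_⟩, hpu⟩, hδ'0, fun q hq => hmax q (hsub hq)⟩,
    ⟨⟨hpair, ⟨u, hu, hpu⟩, hδ, hG, ε, hε, hinc⟩, hsub, rfl, ?_, ?_, hroom, ε', hε', hincr⟩⟩
  · simp only [hS']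
    linarith [hu.2]
  · simp only [hS']
    linarith [hu.2]
  · simp only [hS']
    have := norm_nonneg (p'.1 - S.p.1)
    linarith

theorem exists_seq_of_step {α : Type*} {P : ℕ → α → Prop} {R : ℕ → α → α → Prop} {a : α}
    (ha : P 0 a) (hstep : ∀ n a, P n a → ∃ b, P (n + 1) b ∧ R n a b) :
    ∃ u : ℕ → α, u 0 = a ∧ ∀ n, P n (u n) ∧ R n (u n) (u (n + 1)) := by
  choose! g hg using hstep
  let u : ℕ → α := fun n => Nat.rec a (fun n b => g n b) n
  have hP : ∀ n, P n (u n) := by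
    intro n
    induction n with
    | zero => exact ha
    | succ n ih => exact (hg n (u n) ih).1
  exact ⟨u, rfl, fun n => ⟨hP n, (hg n (u n) (hP n)).2⟩⟩

/-- A Lipschitz function, perturbed by a suitable linear functional, has a directional derivative
that is almost maximal, within a slightly enlarged set of points, among all nearby derivatives with
controlled increments. The sets `M u` increase with `u`, and the enlargement is to the sets with
index below some `v` exceeding the index of the point. -/
theorem exists_almost_locally_maximal [CompleteSpace H] {f : H → ℝ} (hf : LipschitzWith 1 f)
    {M : ℝ → Set H} (hclosed : ∀ u, IsClosed (M u))
    (hmono : ∀ u v, 0 ≤ u → u ≤ v → v ≤ 1 → M u ⊆ M v)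
    (hinter : ∀ u, 0 ≤ u → u < 1 → ∀ z, (∀ v, u < v → v < 1 → z ∈ M v) → z ∈ M u)
    {y : H} {d : ℝ}
    (hne : ∃ q : H × H, DirectedPair f q ∧ (∃ u ∈ Set.Ico (0 : ℝ) 1, q.1 ∈ M u) ∧ ‖q.1 - y‖ < d) :
    ∃ (p : H × H) (ℓ : H), DirectedPair f p ∧ ‖ℓ‖ ≤ 1 ∧ ‖p.1 - y‖ ≤ d ∧
      ∃ u, 0 ≤ u ∧ u < 1 ∧ p.1 ∈ M u ∧ ∀ ε > 0, ∃ ρ > 0, ∃ v, u < v ∧ v < 1 ∧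
        ∀ (q : H × H) (w : ℝ), 0 ≤ w → w < v → q.1 ∈ M w → ‖q.1 - p.1‖ < ρ → DirectedPair f q →
          perturbedDeriv f ℓ p ≤ perturbedDeriv f ℓ q →
          IncrementLE f p.1 q.1 p.2 (1200 * √(perturbedDeriv f ℓ q - perturbedDeriv f ℓ p)) →
          perturbedDeriv f ℓ q < perturbedDeriv f ℓ p + ε := by
  -- the initial stage
  obtain ⟨p₀, ⟨hp₀, ⟨u₀, hu₀, hpu₀⟩, hpd₀⟩, hmax₀⟩ := exists_almost_maximum
    (C := {q : H × H | DirectedPair f q ∧ (∃ u ∈ Set.Ico (0 : ℝ) 1, q.1 ∈ M u) ∧ ‖q.1 - y‖ < d})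
    hne (G := perturbedDeriv f 0) (acc_pos 0)
    (fun q hq => (le_abs_self _).trans (abs_perturbedDeriv_le hf hq.1.1))
  set S₀ : Stage H := ⟨p₀, 0, 1, d - ‖p₀.1 - y‖⟩ with hS₀
  have hvalid₀ : S₀.Valid f M 0 := by
    refine ⟨hp₀, by simp [hS₀], ⟨u₀, hu₀, hpu₀⟩, by simp only [hS₀]; linarith, fun q hq => ?_⟩
    refine hmax₀ q ⟨hq.1, hq.2.1, ?_⟩
    have h1 := hq.2.2.1
    simp only [hS₀] at h1
    have := norm_sub_le_norm_sub_add_norm_sub q.1 p₀.1 y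
    linarith
  obtain ⟨S, hSz, hS⟩ := exists_seq_of_step (P := Stage.Valid f M) (R := Stage.Step f M) hvalid₀
    (fun n S hS => hS.exists_step hf)
  have hV : ∀ n, (S n).Valid f M n := fun n => (hS n).1
  have hT : ∀ n, (S n).Step f M n (S (n + 1)) := fun n => (hS n).2
  -- monotonicity of the candidate sets and of the bounds
  have hanti : Antitone fun n => (S n).next f M n := antitone_nat_of_succ_le fun n => (hT n).subset
  have hmem : ∀ n m, n < m → (S m).p ∈ (S n).next f M n := by
    intro n m hnm
    obtain ⟨k, rfl⟩ : ∃ k, m = k + 1 := ⟨m - 1, by omega⟩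
    exact hanti (by omega : n ≤ k) (hT k).mem_next
  have hsanti : StrictAnti fun n => (S n).s := strictAnti_nat_of_succ_lt fun n => (hT n).lt
  have hδle : ∀ n, (S n).δ ≤ (S 0).δ * (1 / 2) ^ n := by
    intro n
    induction n with
    | zero => simp
    | succ n ih =>
      have := (hT n).half
      rw [pow_succ]
      linarith
  have hδlim : Tendsto (fun n => (S n).δ) atTop (𝓝 0) := by
    refine squeeze_zero (fun n => (hV n).pos.le) hδle ?_
    have := (tendsto_pow_atTop_nhds_zero_of_lt_one (by norm_num : (0 : ℝ) ≤ 1 / 2)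
      (by norm_num)).const_mul (S 0).δ
    simpa using this
  -- convergence of the points
  have hxdist : ∀ n m, n ≤ m → ‖(S m).p.1 - (S n).p.1‖ ≤ (S n).δ := by
    intro n m hnm
    rcases hnm.eq_or_lt with rfl | hlt
    · simpa using (hV n).pos.le
    · exact (hmem n m hlt).2.2.1.le
  obtain ⟨x, hx⟩ := cauchySeq_tendsto_of_complete (cauchySeq_of_norm_sub_le hxdist hδlim)
  have hxle : ∀ n, ‖x - (S n).p.1‖ ≤ (S n).δ := fun n =>
    le_of_tendsto (hx.sub_const _).norm (eventually_atTop.2 ⟨n, fun m hm => hxdist n m hm⟩)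
  have hxlt : ∀ n, ‖x - (S n).p.1‖ < (S n).δ := by
    intro n
    have h1 := hxle (n + 1)
    have h2 := (hT n).room
    have h3 := (hV (n + 1)).pos
    have h4 := norm_sub_le_norm_sub_add_norm_sub x (S (n + 1)).p.1 (S n).p.1
    linarith
  -- convergence of the directions
  have hedist : ∀ n m, n ≤ m → ‖(S m).p.2 - (S n).p.2‖ ≤ tol n / 5 := by
    intro n m hnm
    rcases hnm.eq_or_lt with rfl | hlt
    · have := tol_pos n
      rw [sub_self, norm_zero]
      positivity
    · exact ((hV n).close (hmem n m hlt)).1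
  have htol5 : Tendsto (fun n => tol n / 5) atTop (𝓝 0) := by
    simpa using tendsto_tol.div_const 5
  obtain ⟨e, he⟩ := cauchySeq_tendsto_of_complete (cauchySeq_of_norm_sub_le hedist htol5)
  have hele : ∀ n, ‖e - (S n).p.2‖ ≤ tol n / 5 := fun n =>
    le_of_tendsto (he.sub_const _).norm (eventually_atTop.2 ⟨n, fun m hm => hedist n m hm⟩)
  have hen : ‖e‖ = 1 := by
    refine tendsto_nhds_unique he.norm ?_
    simp_rw [fun n => (hV n).pair.1]
    exact tendsto_const_nhds
  -- convergence of the derivatives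
  have hddist : ∀ n m, n ≤ m → ‖lineDeriv ℝ f (S m).p.1 (S m).p.2
      - lineDeriv ℝ f (S n).p.1 (S n).p.2‖ ≤ tol n := by
    intro n m hnm
    have h0 := tol_pos n
    rcases hnm.eq_or_lt with rfl | hlt
    · simpa using h0.le
    · refine ((hV n).close (hmem n m hlt)).2.1.trans ?_
      have := acc_le_tol n
      linarith
  obtain ⟨c, hc⟩ := cauchySeq_tendsto_of_complete (cauchySeq_of_norm_sub_le hddist tendsto_tol)
  have hcle : ∀ n, |c - lineDeriv ℝ f (S n).p.1 (S n).p.2| ≤ tol n := fun n =>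
    le_of_tendsto (hc.sub_const _).norm (eventually_atTop.2 ⟨n, fun m hm => hddist n m hm⟩)
  -- convergence of the perturbing vectors
  have hℓstep : ∀ n, dist (S n).ℓ (S (n + 1)).ℓ ≤ 1 / 2 / 2 ^ n := by
    intro n
    rw [(hT n).pert_eq, dist_self_add_right, norm_smul, (hV n).pair.1,
      Real.norm_of_nonneg (pert_pos n).le, mul_one]
    unfold pert
    rw [pow_succ, one_div_pow]
    apply le_of_eq; ring
  obtain ⟨ℓ, hℓ⟩ := cauchySeq_tendsto_of_complete (cauchySeq_of_le_geometric_two hℓstep)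
  have hℓle : ∀ n, ‖ℓ - (S n).ℓ‖ ≤ (1 / 2) ^ n := by
    intro n
    have := dist_le_of_le_geometric_two_of_tendsto hℓstep hℓ n
    rw [dist_comm, dist_eq_norm] at this
    rwa [one_div_pow]
  have hℓ1 : ‖ℓ‖ ≤ 1 := le_of_tendsto hℓ.norm (Eventually.of_forall fun n => (hV n).norm_le_one)
  -- increments at the limit point
  have hincr : ∀ n, IncrementLE f (S n).p.1 x (S n).p.2 (2 * tol n) := by
    intro n t
    have hlim : Tendsto (fun m => |f ((S m).p.1 + t • (S n).p.2) - f (S m).p.1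
        - (f ((S n).p.1 + t • (S n).p.2) - f (S n).p.1)|) atTop
        (𝓝 |f (x + t • (S n).p.2) - f x - (f ((S n).p.1 + t • (S n).p.2) - f (S n).p.1)|) := by
      refine Tendsto.abs (Tendsto.sub_const (Tendsto.sub ?_ ?_) _)
      · exact (hf.continuous.tendsto _).comp (hx.add_const _)
      · exact (hf.continuous.tendsto _).comp hx
    refine le_of_tendsto hlim (eventually_atTop.2 ⟨n + 1, fun m hm => ?_⟩)
    have hq := hmem n m (by omega)
    obtain ⟨ε, hε, hi⟩ := hq.2.2.2.2
    refine (hi t).trans ?_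
    gcongr
    have h1 := ((hV n).close hq).2.2
    have h2 := sqrt_acc_le n
    have h3 := Real.sqrt_le_sqrt h1
    linarith
  have hder : HasLineDerivAt ℝ f c x e := by
    rw [hasLineDerivAt_iff_isLittleO_nhds_zero, Asymptotics.isLittleO_iff]
    intro ε hε
    obtain ⟨n, hn⟩ := (tendsto_tol.eventually_lt_const (by positivity : 0 < ε / 5)).exists
    obtain ⟨Δ, hΔ, hd⟩ := exists_forall_abs_sub_le_of_hasLineDerivAt
      (hV n).pair.2.hasLineDerivAt (tol_pos n)
    filter_upwards [Metric.ball_mem_nhds (0 : ℝ) hΔ] with t ht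
    rw [mem_ball_zero_iff, Real.norm_eq_abs] at ht
    have h1 := hd t ht
    have h2 := hincr n t
    have h3 := abs_sub_le_of_lipschitz_one hf (x + t • e) (x + t • (S n).p.2)
    have h4 : x + t • e - (x + t • (S n).p.2) = t • (e - (S n).p.2) := by module
    rw [h4, norm_smul, Real.norm_eq_abs] at h3
    have h5 : |t| * ‖e - (S n).p.2‖ ≤ |t| * (tol n / 5) := by gcongr; exact hele n
    have h6 : |(c - lineDeriv ℝ f (S n).p.1 (S n).p.2) * t| ≤ tol n * |t| := by
      rw [abs_mul]; gcongr; exact hcle n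
    have h7 : tol n * |t| ≤ ε / 5 * |t| := by gcongr
    have h9 : 0 ≤ ε * |t| := by positivity
    have h8 : f (x + t • e) - f x - t • c = (f (x + t • e) - f (x + t • (S n).p.2))
        + (f (x + t • (S n).p.2) - f x - (f ((S n).p.1 + t • (S n).p.2) - f (S n).p.1))
        + (f ((S n).p.1 + t • (S n).p.2) - f (S n).p.1
          - lineDeriv ℝ f (S n).p.1 (S n).p.2 * t)
        - (c - lineDeriv ℝ f (S n).p.1 (S n).p.2) * t := by
      rw [smul_eq_mul]; ring
    rw [h8, Real.norm_eq_abs, Real.norm_eq_abs]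
    refine ((abs_sub _ _).trans (add_le_add_left ((abs_add_le _ _).trans
      (add_le_add_left (abs_add_le _ _) _)) _)).trans ?_
    linarith
  have hpair : DirectedPair f (x, e) := ⟨hen, hder.lineDifferentiableAt⟩
  -- the perturbed derivatives increase to the one at the limit
  have hself : ∀ n, ⟪(S n).p.2, (S n).p.2⟫_ℝ = 1 := fun n => by
    rw [real_inner_self_eq_norm_sq, (hV n).pair.1]; norm_num
  have hsucc : ∀ n, perturbedDeriv f (S (n + 1)).ℓ (S n).p
      = perturbedDeriv f (S n).ℓ (S n).p + pert n := by
    intro n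
    rw [(hT n).pert_eq]
    simp only [perturbedDeriv, inner_add_left, real_inner_smul_left, hself]
    ring
  have hhalf : ∀ n, (1 / 2 : ℝ) ^ n = pert n + (1 / 2) ^ (n + 1) := by
    intro n; unfold pert; rw [pow_succ]; ring
  have hgrow : ∀ n, perturbedDeriv f (S (n + 1)).ℓ (S n).p
      ≤ perturbedDeriv f (S (n + 1)).ℓ (S (n + 1)).p := by
    intro n
    have := (hT n).mem_next.2.2.2.1
    rwa [← (hT n).pert_eq] at this
  set G := perturbedDeriv f ℓ (x, e) with hG
  have hGeq : G = c + ⟪ℓ, e⟫_ℝ := by rw [hG]; simp only [perturbedDeriv]; rw [hder.lineDeriv]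
  have hle : ∀ n, perturbedDeriv f (S n).ℓ (S n).p + (1 / 2) ^ n ≤ G := by
    have hm : Monotone fun n => perturbedDeriv f (S n).ℓ (S n).p + (1 / 2) ^ n := by
      refine monotone_nat_of_le_succ fun n => ?_
      have h1 := hsucc n
      have h2 := hgrow n
      have h3 := hhalf n
      linarith
    have hl : Tendsto (fun n => perturbedDeriv f (S n).ℓ (S n).p + (1 / 2) ^ n) atTop
        (𝓝 (G + 0)) := by
      refine Tendsto.add ?_ (tendsto_pow_atTop_nhds_zero_of_lt_one (by norm_num) (by norm_num))
      rw [hGeq]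
      exact hc.add (hℓ.inner he)
    rw [add_zero] at hl
    exact fun n => hm.ge_of_tendsto hl n
  -- the limiting index
  have hspos : ∀ n, 0 < (S n).s := fun n => by
    obtain ⟨u, hu, -⟩ := (hV n).mem
    exact hu.1.trans_lt hu.2
  have hs1 : ∀ n, (S n).s ≤ 1 := fun n => by
    have := hsanti.antitone (Nat.zero_le n)
    simpa [hSz, hS₀] using this
  have hbdd : BddBelow (Set.range fun n => (S n).s) := ⟨0, by rintro _ ⟨n, rfl⟩; exact (hspos n).le⟩
  set u := ⨅ n, (S n).s with hu
  have hu0 : 0 ≤ u := le_ciInf fun n => (hspos n).le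
  have hus : ∀ n, u < (S n).s := fun n => (ciInf_le hbdd (n + 1)).trans_lt (hT n).lt
  have hxM : ∀ n, x ∈ M (S n).s := by
    intro n
    refine (hclosed _).mem_of_tendsto hx (eventually_atTop.2 ⟨n + 1, fun m hm => ?_⟩)
    obtain ⟨w, hw, hwm⟩ := (hmem n m (by omega)).2.1
    exact hmono w _ hw.1 hw.2.le (hs1 n) hwm
  have hu1 : u < 1 := (hus 0).trans_le (hs1 0)
  have hxu : x ∈ M u := by
    refine hinter u hu0 hu1 x fun v huv hv1 => ?_
    obtain ⟨n, hn⟩ := exists_lt_of_ciInf_lt huv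
    exact hmono _ _ (hspos n).le hn.le hv1.le (hxM n)
  have hxy : ‖x - y‖ ≤ d := by
    have h1 := hxle 0
    have h2 := norm_sub_le_norm_sub_add_norm_sub x (S 0).p.1 y
    simp only [hSz, hS₀] at h1 h2
    linarith
  refine ⟨(x, e), ℓ, hpair, hℓ1, hxy, u, hu0, hu1, hxu, fun ε hε => ?_⟩
  -- almost maximality
  obtain ⟨n, hn⟩ := (tendsto_tol.eventually_lt_const hε).exists
  have hσ := tol_pos (n + 1)
  obtain ⟨δ₁, hδ₁, ε₁, hε₁, htr⟩ := IncrementLE.trans hf (hV (n + 1)).pair.2.hasLineDerivAt hder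
    (σ := 3 * tol (n + 1)) (σ' := 0) (ε := tol (n + 1)) (β := tol (n + 1)) (W := 0) hσ hσ (by
      have h1 := hcle (n + 1)
      have h2 := hele (n + 1)
      linarith) ((hincr (n + 1)).mono (by linarith))
  refine ⟨min δ₁ ((S (n + 1)).δ - ‖x - (S (n + 1)).p.1‖), lt_min hδ₁ (by linarith [hxlt (n + 1)]),
    (S (n + 1)).s, hus _, (hT n).lt.trans_le (hs1 n), ?_⟩
  intro q w hw0 hwv hqw hqρ hqp hqG hqI
  simp only at hqρ hqI
  have hqx : ‖q.1 - (S (n + 1)).p.1‖ ≤ (S (n + 1)).δ := by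
    have h1 := hqρ.le.trans (min_le_right _ _)
    have h2 := norm_sub_le_norm_sub_add_norm_sub q.1 x (S (n + 1)).p.1
    linarith
  have hdiff : ∀ m, |perturbedDeriv f ℓ q - perturbedDeriv f (S m).ℓ q| ≤ (1 / 2) ^ m := by
    intro m
    have h1 : perturbedDeriv f ℓ q - perturbedDeriv f (S m).ℓ q = ⟪ℓ - (S m).ℓ, q.2⟫_ℝ := by
      simp only [perturbedDeriv, inner_sub_left]; ring
    rw [h1]
    refine (abs_real_inner_le_norm _ _).trans ?_
    rw [hqp.1, mul_one]
    exact hℓle m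
  have hd1 := abs_le.1 (hdiff (n + 1))
  have hG1 : perturbedDeriv f (S (n + 1)).ℓ (S (n + 1)).p ≤ perturbedDeriv f (S (n + 1)).ℓ q := by
    have := hle (n + 1)
    linarith
  have hG2 := hgrow n
  have hgain : perturbedDeriv f ℓ q - G
      ≤ perturbedDeriv f (S (n + 1)).ℓ q - perturbedDeriv f (S (n + 1)).ℓ (S n).p := by
    have h1 := hle n
    have h2 := hsucc n
    have h3 := hhalf n
    linarith
  have hcand : q ∈ (S n).next f M n := by
    refine ⟨hqp, ⟨w, ⟨hw0, hwv.trans (hT n).lt⟩, hqw⟩, ?_, ?_, ?_⟩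
    · have h1 := (hT n).room
      have h2 := norm_sub_le_norm_sub_add_norm_sub q.1 (S (n + 1)).p.1 (S n).p.1
      have h3 := (hV (n + 1)).pos
      linarith
    · rw [← (hT n).pert_eq]
      exact hG2.trans hG1
    · rw [← (hT n).pert_eq]
      obtain ⟨ε₂, hε₂, hstep⟩ := (hT n).incr
      refine ⟨ε₂, hε₂, hstep q.1 hqx _ _ (by linarith) hgain ?_⟩
      refine (htr q.1 (hqρ.le.trans (min_le_left _ _)) (1200 * √(perturbedDeriv f ℓ q - G))
        (1200 * √(perturbedDeriv f ℓ q - G)) (by positivity) le_rfl (by rwa [zero_add])).mono ?_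
      linarith
  have h1 := (hV n).max q hcand
  have h2 := hle n
  have h3 := (abs_le.1 (hdiff n)).2
  have h4 := acc_le_tol n
  have h5 := tol_pos n
  linarith

theorem hasLineDerivAt_add_inner {f : H → ℝ} {ℓ x e : H} {a : ℝ} (h : HasLineDerivAt ℝ f a x e) :
    HasLineDerivAt ℝ (fun z => f z + ⟪ℓ, z⟫_ℝ) (a + ⟪ℓ, e⟫_ℝ) x e := by
  have h1 : HasLineDerivAt ℝ (fun z => ⟪ℓ, z⟫_ℝ) ⟪ℓ, e⟫_ℝ x e :=
    (innerSL ℝ ℓ).hasFDerivAt.hasLineDerivAt e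
  unfold HasLineDerivAt at *
  exact h.add h1

/-- A set in which short segments near `y` can be approximated contains, arbitrarily close to `y`,
points with a directional derivative, since Lipschitz functions of one variable are differentiable
almost everywhere. -/
theorem exists_directedPair [Nontrivial H] {f : H → ℝ} (hf : LipschitzWith 1 f) {M : Set H} {y : H}
    (hM : ApproximableAt M y) {d : ℝ} (hd : 0 < d) :
    ∃ q : H × H, DirectedPair f q ∧ q.1 ∈ M ∧ ‖q.1 - y‖ < d := by
  obtain ⟨δ₀, hδ₀, happ⟩ := hM (1 / 4) (by norm_num)
  obtain ⟨e₀, he₀⟩ := exists_norm_eq H (zero_le_one' ℝ)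
  set δ := min (δ₀ / 2) (d / 4) with hδ
  have hδ0 : 0 < δ := by positivity
  have hn : ‖y + δ • e₀ - y‖ = δ := by
    rw [add_sub_cancel_left, norm_smul, he₀, Real.norm_of_nonneg hδ0.le, mul_one]
  obtain ⟨A, B, hA, hB, hAB⟩ := happ δ hδ0 ((min_le_left _ _).trans_lt (by linarith)) y
    (y + δ • e₀) (by simpa using hδ0.le) hn.le
  set w := B - A with hw
  have hw0 : w ≠ 0 := by
    intro h0
    have h1 : B = A := sub_eq_zero.1 h0
    rw [h1] at hB
    have h2 := norm_sub_le_norm_sub_add_norm_sub (y + δ • e₀) A y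
    rw [norm_sub_rev] at hB
    linarith
  have hφ : LipschitzWith (1 * ‖w‖₊) (fun s : ℝ => f (A + s • w)) := by
    refine hf.comp (LipschitzWith.of_dist_le_mul fun s t => ?_)
    rw [dist_add_left, dist_eq_norm, ← sub_smul, norm_smul, mul_comm]
    rfl
  have hpos : volume (Set.Ioo (0 : ℝ) 1) ≠ 0 := by simp
  obtain ⟨s, hs, hsd⟩ : ∃ s ∈ Set.Ioo (0 : ℝ) 1,
      DifferentiableAt ℝ (fun s : ℝ => f (A + s • w)) s := by
    by_contra! hcon
    refine hpos (measure_mono_null (fun s hs => ?_) (ae_iff.1 hφ.ae_differentiableAt_real))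
    exact hcon s hs
  have hline : LineDifferentiableAt ℝ f (A + s • w) w := by
    have h0 : HasDerivAt (fun s : ℝ => f (A + s • w)) (deriv (fun s : ℝ => f (A + s • w)) s)
        (s + 0) := by
      rw [add_zero]
      exact hsd.hasDerivAt
    have h1 : DifferentiableAt ℝ (fun t : ℝ => f (A + (s + t) • w)) 0 :=
      (h0.comp_const_add s 0).differentiableAt
    refine h1.congr_of_eventuallyEq (Eventually.of_forall fun t => ?_)
    simp only
    congr 1
    module
  refine ⟨(A + s • w, ‖w‖⁻¹ • w), ⟨?_, hline.smul _⟩, hAB ?_, ?_⟩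
  · simp only
    rw [norm_smul, norm_inv, norm_norm, inv_mul_cancel₀ (norm_ne_zero_iff.2 hw0)]
  · rw [segment_eq_image']
    exact ⟨s, ⟨hs.1.le, hs.2.le⟩, rfl⟩
  · have h1 : A + s • w - y = (1 - s) • (A - y) + s • (B - (y + δ • e₀)) + (s * δ) • e₀ := by
      rw [hw]; module
    have h2 : δ ≤ d / 4 := min_le_right _ _
    simp only
    rw [h1]
    refine (norm_add_le _ _).trans_lt ((add_le_add_left (norm_add_le _ _) _).trans_lt ?_)
    rw [norm_smul, norm_smul, norm_smul, he₀, Real.norm_of_nonneg (by linarith [hs.2]),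
      Real.norm_of_nonneg hs.1.le, Real.norm_of_nonneg (by have := hs.1; positivity)]
    have h3 : (1 - s) * ‖A - y‖ ≤ 1 * (1 / 4 * δ) := by
      gcongr
      linarith [hs.1]
    have h4 : s * ‖B - (y + δ • e₀)‖ ≤ 1 * (1 / 4 * δ) := by
      gcongr
      exact hs.2.le
    have h5 : s * δ ≤ 1 * δ := by
      gcongr
      exact hs.2.le
    linarith

/-- Let the closed sets `M u` increase continuously from the right with `u`, and let short segments
near points of `M u` be approximable in `M v` for `u < v`. Then every Lipschitz function has points
of differentiability in these sets near any point of `M 0`. At an almost maximal directional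
derivative of a perturbation of the function, the failure of differentiability would produce a
larger directional derivative nearby. -/
theorem exists_differentiableAt_of_approximable [CompleteSpace H] [Nontrivial H] {M : ℝ → Set H}
    (hclosed : ∀ u, IsClosed (M u)) (hmono : ∀ u v, 0 ≤ u → u ≤ v → v ≤ 1 → M u ⊆ M v)
    (hinter : ∀ u, 0 ≤ u → u < 1 → ∀ z, (∀ v, u < v → v < 1 → z ∈ M v) → z ∈ M u)
    (happ : ∀ u v, 0 ≤ u → u < v → v < 1 → ∀ x ∈ M u, ApproximableAt (M v) x)
    {y : H} (hy : y ∈ M 0) {d : ℝ} (hd : 0 < d) {g : H → ℝ} {K : ℝ≥0} (hg : LipschitzWith K g) :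
    ∃ x ∈ M 1, ‖x - y‖ ≤ d ∧ DifferentiableAt ℝ g x := by
  -- normalisation of the Lipschitz constant
  set f : H → ℝ := fun z => (K + 1 : ℝ)⁻¹ * g z with hfdef
  have hK0 : (0 : ℝ) < K + 1 := by positivity
  have hf : LipschitzWith 1 f := by
    refine LipschitzWith.of_dist_le_mul fun a b => ?_
    have h1 := hg.dist_le_mul a b
    simp only [hfdef]
    rw [Real.dist_eq, ← mul_sub, abs_mul, abs_of_pos (inv_pos.2 hK0), inv_mul_le_iff₀ hK0,
      ← Real.dist_eq, NNReal.coe_one, one_mul]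
    nlinarith [dist_nonneg (x := a) (y := b)]
  obtain ⟨q₀, hq₀, hq₀M, hq₀d⟩ := exists_directedPair hf
    (happ 0 (1 / 2) le_rfl (by norm_num) (by norm_num) y hy) hd
  obtain ⟨p, ℓ, hp, hℓ, hpy, u, hu0, hu1, hpu, hmax⟩ := exists_almost_locally_maximal hf hclosed
    hmono hinter (y := y) (d := d) ⟨q₀, hq₀, ⟨1 / 2, ⟨by norm_num, by norm_num⟩, hq₀M⟩, hq₀d⟩
  refine ⟨p.1, hmono u 1 hu0 hu1.le le_rfl hpu, hpy, ?_⟩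
  by_contra hnd
  set F : H → ℝ := fun z => f z + ⟪ℓ, z⟫_ℝ with hFdef
  have hlin : LipschitzWith 1 (fun z : H => ⟪ℓ, z⟫_ℝ) := by
    refine LipschitzWith.of_dist_le_mul fun a b => ?_
    rw [Real.dist_eq, ← inner_sub_right, NNReal.coe_one, dist_eq_norm]
    refine (abs_real_inner_le_norm _ _).trans ?_
    gcongr
  have hF : LipschitzWith 2 F := by
    have := hf.add hlin
    norm_num at this
    exact this
  have hFnd : ¬ DifferentiableAt ℝ F p.1 := by
    intro hFd
    apply hnd
    have h1 : g = fun z => (K + 1 : ℝ) * (F z - innerSL ℝ ℓ z) := by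
      ext z
      simp only [hFdef, hfdef, innerSL_apply_apply, add_sub_cancel_right]
      field_simp
    rw [h1]
    exact (hFd.sub (innerSL ℝ ℓ).differentiableAt).const_mul _
  obtain ⟨γ, hγ, himp⟩ := exists_improved_direction hF hp.1
    (hasLineDerivAt_add_inner (ℓ := ℓ) hp.2.hasLineDerivAt) hFnd
  obtain ⟨ρ, hρ, v, huv, hv1, hloc⟩ := hmax γ hγ
  obtain ⟨z, hzM, hzρ, e', c', he', hc', hcc', hinc⟩ := himp (M ((u + v) / 2))
    (happ u _ hu0 (by linarith) (by linarith) p.1 hpu) ρ hρ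
  have hline : HasLineDerivAt ℝ f (c' - ⟪ℓ, e'⟫_ℝ) z e' := by
    have h1 := hasLineDerivAt_add_inner (ℓ := -ℓ) hc'
    have h2 : (fun z => F z + ⟪-ℓ, z⟫_ℝ) = f := by
      ext z
      simp [hFdef, inner_neg_left]
    rw [h2, inner_neg_left, ← sub_eq_add_neg] at h1
    exact h1
  have hpert : perturbedDeriv f ℓ (z, e') = c' := by
    simp only [perturbedDeriv]
    rw [hline.lineDeriv]; ring
  have hcp : lineDeriv ℝ f p.1 p.2 + ⟪ℓ, p.2⟫_ℝ = perturbedDeriv f ℓ p := rfl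
  rw [hcp] at hcc' hinc
  have := hloc (z, e') ((u + v) / 2) (by linarith) (by linarith) hzM hzρ
    ⟨he', hline.lineDifferentiableAt⟩ (by rw [hpert]; linarith) (by
      intro t
      refine le_trans (le_of_eq ?_) (hinc t |>.trans (by rw [hpert]))
      simp only [hFdef, inner_add_right]
      congr 1; ring)
  rw [hpert] at this
  linarith

end Maximal

/-! ### Lines avoiding the squares -/

theorem scale_zero (N : ℕ → ℕ) : scale N 0 = 1 := by simp [scale]

theorem scale_pos {N : ℕ → ℕ} (hN : ∀ r, 1 < N r) (r : ℕ) : 0 < scale N r := by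
  unfold scale
  have : 0 < ∏ s ∈ Finset.range r, (N s : ℝ) :=
    Finset.prod_pos fun s _ => by have := hN s; positivity
  positivity

theorem scale_eq_mul {N : ℕ → ℕ} (hN : ∀ r, 1 < N r) (r : ℕ) :
    scale N r = N r * scale N (r + 1) := by
  unfold scale
  rw [Finset.prod_range_succ]
  have h1 : (N r : ℝ) ≠ 0 := by have := hN r; positivity
  field_simp

theorem scale_eq_nat_mul {N : ℕ → ℕ} (hN : ∀ r, 1 < N r) {m r : ℕ} (h : m ≤ r) :
    ∃ k : ℕ, scale N m = k * scale N r := by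
  induction r, h using Nat.le_induction with
  | base => exact ⟨1, by simp⟩
  | succ r _ ih =>
    obtain ⟨k, hk⟩ := ih
    refine ⟨k * N r, ?_⟩
    rw [hk, scale_eq_mul hN r]; push_cast; ring

theorem scale_antitone {N : ℕ → ℕ} (hN : ∀ r, 1 < N r) : Antitone (scale N) := by
  refine antitone_nat_of_succ_le fun r => ?_
  rw [scale_eq_mul hN r]
  have h1 : (1 : ℝ) ≤ N r := by exact_mod_cast (hN r).le
  exact le_mul_of_one_le_left (scale_pos hN _).le h1

theorem scale_le_pow {N : ℕ → ℕ} (hN : ∀ r, 1 < N r) (r : ℕ) : scale N r ≤ (1 / 2) ^ r := by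
  induction r with
  | zero => simp [scale]
  | succ r ih =>
    have h1 : (2 : ℝ) ≤ N r := by exact_mod_cast hN r
    have h2 := scale_eq_mul hN r
    have h3 := scale_pos hN (r + 1)
    rw [pow_succ]
    nlinarith

theorem mem_planarSet {N : ℕ → ℕ} {i : ℕ → ℝ} {P : ℝ × ℝ} :
    P ∈ planarSet N i ↔ ∀ (r : ℕ) (a b : ℤ), 1 / 2 * i r * scale N (r + 1)
      ≤ dist P (scale N r * (1 / 2 + a), scale N r * (1 / 2 + b)) := by
  simp only [planarSet, lattice, Set.mem_compl_iff, Set.mem_iUnion, Metric.mem_ball, not_exists,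
    Set.mem_ofPred_eq, not_lt]
  constructor
  · intro h r a b
    exact h r _ ⟨a, b, rfl⟩
  · rintro h r c ⟨a, b, rfl⟩
    exact h r a b

theorem planarSet_anti {N : ℕ → ℕ} (hN : ∀ r, 1 < N r) {i j : ℕ → ℝ} (hij : ∀ r, i r ≤ j r) :
    planarSet N j ⊆ planarSet N i := by
  intro P hP
  rw [mem_planarSet] at *
  intro r a b
  refine le_trans ?_ (hP r a b)
  have := scale_pos hN (r + 1)
  gcongr
  exact hij r

theorem isClosed_planarSet (N : ℕ → ℕ) (i : ℕ → ℝ) : IsClosed (planarSet N i) :=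
  (isOpen_iUnion fun _ => isOpen_biUnion fun _ _ => Metric.isOpen_ball).isClosed_compl

/-- Every vector is approximated by a multiple of an integer vector `(q, p)` of bounded size, with
entries of different parity. -/
theorem exists_odd_direction {Q : ℕ} (hQ : 0 < Q) (hQe : Even Q) {a b D : ℝ} (ha : |a| ≤ D)
    (hb : |b| ≤ D) :
    ∃ (p q : ℤ) (lam : ℝ), Odd (q - p) ∧ |(p : ℝ)| ≤ Q + 1 ∧ |(q : ℝ)| ≤ Q + 1 ∧
      |a - lam * q| ≤ D / Q ∧ |b - lam * p| ≤ D / Q := by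
  have hQ0 : (0 : ℝ) < Q := by exact_mod_cast hQ
  have key : ∀ a b : ℝ, |b| ≤ |a| → |a| ≤ D → ∃ (p : ℤ) (lam : ℝ), Odd p ∧ |(p : ℝ)| ≤ Q + 1 ∧
      |a - lam * Q| ≤ D / Q ∧ |b - lam * p| ≤ D / Q := by
    intro a b hba haD
    have hD : 0 ≤ D := (abs_nonneg a).trans haD
    set y := Q * b / a with hy
    have hyQ : |y| ≤ Q := by
      rw [hy, abs_div, abs_mul, Nat.abs_cast]
      exact div_le_of_le_mul₀ (abs_nonneg a) hQ0.le (by gcongr)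
    have hpy : |((2 * ⌊y / 2⌋ + 1 : ℤ) : ℝ) - y| ≤ 1 := by
      have h1 := Int.floor_le (y / 2)
      have h2 := Int.lt_floor_add_one (y / 2)
      push_cast
      rw [abs_le]
      constructor <;> linarith
    refine ⟨2 * ⌊y / 2⌋ + 1, a / Q, ⟨_, rfl⟩, ?_, ?_, ?_⟩
    · have h1 := abs_le.1 hpy
      have h2 := abs_le.1 hyQ
      rw [abs_le]
      constructor <;> linarith
    · rw [div_mul_cancel₀ _ hQ0.ne', sub_self, abs_zero]
      positivity
    · by_cases ha0 : a = 0
      · have hb0 : b = 0 := by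
          rw [ha0, abs_zero] at hba
          exact abs_eq_zero.1 (le_antisymm hba (abs_nonneg b))
        rw [ha0, hb0]
        simp only [zero_div, zero_mul, sub_zero, abs_zero]
        positivity
      · have h1 : b = a / Q * y := by rw [hy]; field_simp
        have h2 : b - a / Q * ((2 * ⌊y / 2⌋ + 1 : ℤ) : ℝ)
            = -(a / Q * (((2 * ⌊y / 2⌋ + 1 : ℤ) : ℝ) - y)) := by
          rw [mul_sub, ← h1]; ring
        rw [h2, abs_neg, abs_mul, abs_div, Nat.abs_cast]
        calc |a| / Q * |((2 * ⌊y / 2⌋ + 1 : ℤ) : ℝ) - y| ≤ D / Q * 1 := by gcongr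
          _ = D / Q := mul_one _
  have hQn : |((Q : ℤ) : ℝ)| ≤ Q + 1 := by
    rw [Int.cast_natCast, Nat.abs_cast]; linarith
  have hQe' : Even (Q : ℤ) := by exact_mod_cast hQe
  rcases le_total |b| |a| with h | h
  · obtain ⟨p, lam, hp, hpQ, h1, h2⟩ := key a b h ha
    exact ⟨p, Q, lam, hQe'.sub_odd hp, hpQ, hQn, by simpa using h1, h2⟩
  · obtain ⟨q, lam, hq, hqQ, h1, h2⟩ := key b a h hb
    exact ⟨Q, q, lam, hq.sub_even hQe', hQn, hqQ, h2, by simpa using h1⟩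

/-- An integer can be moved by at most `2 * R + 1` so as to have distance at least `R` from all the
points of `n * (1 / 2 + ℤ)`, provided these points are sparse enough. -/
theorem exists_int_far {n R : ℝ} (hR : 0 ≤ R) (hn : 4 * R + 1 ≤ n) (z₀ : ℤ) :
    ∃ z : ℤ, z₀ ≤ z ∧ (z : ℝ) ≤ z₀ + (2 * R + 1) ∧ ∀ k : ℤ, R ≤ |(z : ℝ) - n * (1 / 2 + k)| := by
  by_cases hz : ∀ k : ℤ, R ≤ |(z₀ : ℝ) - n * (1 / 2 + k)|
  · exact ⟨z₀, le_rfl, by linarith, hz⟩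
  push Not at hz
  obtain ⟨k₀, hk₀⟩ := hz
  have h1 := Int.le_ceil (2 * R)
  have h2 := Int.ceil_lt_add_one (2 * R)
  have h3 := abs_lt.1 hk₀
  have h0 : 0 ≤ ⌈2 * R⌉ := Int.ceil_nonneg (by positivity)
  refine ⟨z₀ + ⌈2 * R⌉, by linarith, by push_cast; linarith, fun k => ?_⟩
  push_cast
  rcases lt_trichotomy k k₀ with hk | rfl | hk
  · have h4 : (k : ℝ) + 1 ≤ k₀ := by exact_mod_cast hk
    rw [le_abs]
    left
    nlinarith
  · rw [le_abs]
    left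
    linarith
  · have h4 : (k₀ : ℝ) + 1 ≤ k := by exact_mod_cast hk
    rw [le_abs]
    right
    nlinarith

theorem exists_pos_le_of_finite {f : ℕ → ℝ} (hf : ∀ r, 0 < f r) (m : ℕ) :
    ∃ c > 0, ∀ r < m, c ≤ f r := by
  induction m with
  | zero => exact ⟨1, one_pos, fun r hr => absurd hr (Nat.not_lt_zero r)⟩
  | succ m ih =>
    obtain ⟨c, hc, h⟩ := ih
    refine ⟨min c (f m), lt_min hc (hf m), fun r hr => ?_⟩
    rcases Nat.lt_succ_iff_lt_or_eq.1 hr with h1 | rfl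
    · exact (min_le_left _ _).trans (h r h1)
    · exact min_le_right _ _

/-- The values of the linear form `(x, y) ↦ q * y - p * x` at two points bound the distance of the
points from below. -/
theorem abs_form_sub_le {p q T : ℝ} (hT : |p| + |q| ≤ T) (P c : ℝ × ℝ) :
    |(q * P.2 - p * P.1) - (q * c.2 - p * c.1)| ≤ T * dist P c := by
  have h1 : dist P.1 c.1 ≤ dist P c := by rw [Prod.dist_eq]; exact le_max_left _ _
  have h2 : dist P.2 c.2 ≤ dist P c := by rw [Prod.dist_eq]; exact le_max_right _ _
  rw [Real.dist_eq] at h1 h2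
  have h3 : (q * P.2 - p * P.1) - (q * c.2 - p * c.1) = q * (P.2 - c.2) - p * (P.1 - c.1) := by ring
  rw [h3]
  refine (abs_sub _ _).trans ?_
  rw [abs_mul, abs_mul]
  calc |q| * |P.2 - c.2| + |p| * |P.1 - c.1| ≤ |q| * dist P c + |p| * dist P c := by gcongr
    _ = (|p| + |q|) * dist P c := by ring
    _ ≤ T * dist P c := by gcongr

/-- On the centres of the squares of order `r`, the form with coefficients of different parity takes
values in the odd multiples of half the scale. -/
theorem form_lattice {p q : ℤ} (hpq : Odd (q - p)) (a b : ℤ) :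
    ∃ k : ℤ, ∀ s : ℝ, q * (s * (1 / 2 + b)) - p * (s * (1 / 2 + a)) = s * (1 / 2 + k) := by
  obtain ⟨h, hh⟩ := hpq
  refine ⟨h + q * b - p * a, fun s => ?_⟩
  have h1 : (q : ℝ) = p + 2 * h + 1 := by
    have : q = p + 2 * h + 1 := by linarith
    exact_mod_cast this
  push_cast
  rw [h1]; ring

/-- A point at which the form takes an integer multiple of `scale N m` avoids all squares of
order at least `m` whose side is small compared to the scale. -/
theorem le_dist_of_form_eq {N : ℕ → ℕ} (hN : ∀ r, 1 < N r) {p q : ℤ} (hpq : Odd (q - p)) {T J : ℝ}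
    (hT : |(p : ℝ)| + |(q : ℝ)| ≤ T) (hT0 : 0 < T) {m r : ℕ} (hmr : m ≤ r) (hJ : T * J ≤ N r)
    {P : ℝ × ℝ} {z : ℤ} (hP : q * P.2 - p * P.1 = scale N m * z) (a b : ℤ) :
    1 / 2 * J * scale N (r + 1)
      ≤ dist P (scale N r * (1 / 2 + a), scale N r * (1 / 2 + b)) := by
  obtain ⟨k, hk⟩ := form_lattice hpq a b
  obtain ⟨n, hn⟩ := scale_eq_nat_mul hN hmr
  have h1 := abs_form_sub_le hT P (scale N r * (1 / 2 + a), scale N r * (1 / 2 + b))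
  simp only [hP, hk, hn] at h1
  have h2 : (n : ℝ) * scale N r * z - scale N r * (1 / 2 + k)
      = scale N r * (((n * z - k : ℤ) : ℝ) - 1 / 2) := by push_cast; ring
  have hs := scale_pos hN r
  have hs1 := scale_pos hN (r + 1)
  have h3 : (1 : ℝ) / 2 ≤ |((n * z - k : ℤ) : ℝ) - 1 / 2| := by
    rw [le_abs]
    rcases le_or_gt (n * z - k : ℤ) 0 with h | h
    · right
      have : ((n * z - k : ℤ) : ℝ) ≤ 0 := by exact_mod_cast h
      linarith
    · left
      have : (1 : ℝ) ≤ ((n * z - k : ℤ) : ℝ) := by exact_mod_cast h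
      linarith
  rw [h2, abs_mul, abs_of_pos hs] at h1
  have h4 : scale N r * (1 / 2) ≤ T * dist P (scale N r * (1 / 2 + a), scale N r * (1 / 2 + b)) :=
    le_trans (by gcongr) h1
  have h5 : T * (1 / 2 * J * scale N (r + 1)) ≤ scale N r * (1 / 2) := by
    rw [scale_eq_mul hN r]
    calc T * (1 / 2 * J * scale N (r + 1)) = (T * J) * (scale N (r + 1) * (1 / 2)) := by ring
      _ ≤ N r * (scale N (r + 1) * (1 / 2)) := by gcongr
      _ = _ := by ring
  exact le_of_mul_le_mul_left (h5.trans h4) hT0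

/-- Short segments near a point of `planarSet N i` are approximable in `planarSet N j` if
`i ≺ j`. At the scale `δ`, with `scale N (m + 1) ≤ ε * δ / 8 < scale N m`, the squares of order
below `m` are too far away to matter. Directions `(q, p)` with `q - p` odd are dense enough, and on
the lines `q * y - p * x = scale N (m + 1) * z` with an integer `z` no square of order
above `m` is met. The squares of order `m` are either far away or so small that they are avoided by
a small change of `z`. -/
theorem approximableAt_planarSet {N : ℕ → ℕ} (hN : ∀ r, 1 < N r) {i j : ℕ → ℝ} (hj1 : ∀ r, 1 ≤ j r)
    (hjN : Tendsto (fun r => j r / N r) atTop (𝓝 0)) (hij : Prec i j) {x : ℝ × ℝ}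
    (hx : x ∈ planarSet N i) : ApproximableAt (planarSet N j) x := by
  intro ε₀ hε₀
  set ε := min ε₀ 1 with hε
  have hε0 : 0 < ε := lt_min hε₀ one_pos
  have hε1 : ε ≤ 1 := min_le_right _ _
  have hsp := scale_pos hN
  obtain ⟨Q₀, hQ₀⟩ := exists_nat_gt (2 / ε)
  have hQ₀0 : (0 : ℝ) < Q₀ := lt_trans (by positivity) hQ₀
  set Q := 2 * Q₀ with hQ
  have hQ0 : 0 < Q := by
    have : 0 < Q₀ := by exact_mod_cast hQ₀0
    omega
  have hQε : 2 / (Q : ℝ) ≤ ε / 2 := by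
    rw [div_lt_iff₀ hε0] at hQ₀
    rw [hQ]; push_cast
    rw [div_le_iff₀ (by positivity)]
    linarith
  set T : ℝ := 2 * (Q + 1) with hT
  have hT0 : 0 < T := by positivity
  have hT1 : 1 ≤ T := by
    have : (0 : ℝ) ≤ Q := Nat.cast_nonneg _
    linarith
  set C : ℝ := 32 / ε + 16 * T / ε with hC
  have hC0 : 0 < C := by positivity
  -- thresholds for the orders
  obtain ⟨r₀, hr₀⟩ : ∃ r₀, ∀ r ≥ r₀, (2 * T + 1) * j r ≤ N r := by
    have h1 := hjN.eventually_lt_const (show (0 : ℝ) < 1 / (2 * T + 1) by positivity)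
    obtain ⟨r₀, h2⟩ := eventually_atTop.1 h1
    refine ⟨r₀, fun r hr => ?_⟩
    have h3 := h2 r hr
    have hNr : (0 : ℝ) < N r := by have := hN r; positivity
    rw [div_lt_div_iff₀ hNr (by positivity)] at h3
    linarith
  obtain ⟨r₁, hr₁⟩ : ∃ r₁, ∀ r ≥ r₁, C * j r ≤ i r - j r := by
    obtain ⟨r₁, h2⟩ := eventually_atTop.1 (hij.2.eventually_ge_atTop (C + 1))
    refine ⟨r₁, fun r hr => ?_⟩
    have h3 := h2 r hr
    have := hj1 r
    rw [le_div_iff₀ (by linarith)] at h3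
    linarith
  obtain ⟨c, hc, hcle⟩ := exists_pos_le_of_finite
    (f := fun r => (i r - j r) * scale N (r + 1))
    (fun r => mul_pos (sub_pos.2 (hij.1 r)) (hsp _)) r₁
  set r₂ := max r₀ r₁ with hr₂
  refine ⟨min (c / 4) (8 / ε * scale N r₂), lt_min (by positivity) (by have := hsp r₂; positivity),
    fun δ hδ hδlt A B hA hB => ?_⟩
  have hδc : 4 * δ ≤ c := by
    have := hδlt.le.trans (min_le_left _ _)
    linarith
  have hδr : ε / 8 * δ < scale N r₂ := by
    have h1 := hδlt.trans_le (min_le_right _ _)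
    calc ε / 8 * δ < ε / 8 * (8 / ε * scale N r₂) := by gcongr
      _ = scale N r₂ := by field_simp
  -- the critical order
  obtain ⟨m, hmr, hm1, hm2⟩ : ∃ m, r₂ ≤ m ∧ scale N (m + 1) ≤ ε / 8 * δ ∧
      ε / 8 * δ < scale N m := by
    have hex : ∃ m, scale N m ≤ ε / 8 * δ := by
      obtain ⟨m, hm⟩ := exists_pow_lt_of_lt_one (show 0 < ε / 8 * δ by positivity)
        (show (1 / 2 : ℝ) < 1 by norm_num)
      exact ⟨m, (scale_le_pow hN m).trans hm.le⟩
    classical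
    have hlt : r₂ < Nat.find hex := by
      by_contra hcon
      push Not at hcon
      have h1 := scale_antitone hN hcon
      have h2 := Nat.find_spec hex
      linarith
    obtain ⟨m, hm⟩ : ∃ m, Nat.find hex = m + 1 := ⟨Nat.find hex - 1, by omega⟩
    refine ⟨m, by omega, by rw [← hm]; exact Nat.find_spec hex, ?_⟩
    exact not_le.1 (Nat.find_min hex (by omega : m < Nat.find hex))
  have hmr₀ : r₀ ≤ m := (le_max_left _ _).trans hmr
  have hmr₁ : r₁ ≤ m := (le_max_right _ _).trans hmr
  have hs := hsp (m + 1)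
  -- the direction of the line
  have hAB : ‖B - A‖ ≤ 2 * δ := by
    have := norm_sub_le_norm_sub_add_norm_sub B x A
    rw [norm_sub_rev x A] at this
    linarith
  obtain ⟨p, q, lam, hpq, hpQ, hqQ, hlq, hlp⟩ := exists_odd_direction hQ0 ⟨Q₀, by omega⟩
    (a := (B - A).1) (b := (B - A).2) (D := 2 * δ) ((norm_fst_le (B - A)).trans hAB)
    ((norm_snd_le (B - A)).trans hAB)
  have hpqT : |(p : ℝ)| + |(q : ℝ)| ≤ T := by linarith
  have hQδ : 2 * δ / Q ≤ ε / 2 * δ := by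
    rw [mul_div_right_comm]; gcongr
  -- the line itself
  set z₀ := ⌊(q * A.2 - p * A.1) / scale N (m + 1)⌋ with hz₀
  have hz₀1 : scale N (m + 1) * z₀ ≤ q * A.2 - p * A.1 := by
    have := Int.floor_le ((q * A.2 - p * A.1) / scale N (m + 1))
    rw [le_div_iff₀ hs] at this
    linarith
  have hz₀2 : q * A.2 - p * A.1 ≤ scale N (m + 1) * z₀ + scale N (m + 1) := by
    have := (Int.lt_floor_add_one ((q * A.2 - p * A.1) / scale N (m + 1))).le
    rw [div_le_iff₀ hs] at this
    linarith
  obtain ⟨z, hzA, hzm⟩ : ∃ z : ℤ, |scale N (m + 1) * z - (q * A.2 - p * A.1)| ≤ ε / 2 * δ ∧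
      (4 * δ ≤ (i m - j m) * scale N (m + 1) ∨
        ∀ k : ℤ, 1 / 2 * T * j m ≤ |(z : ℝ) - N m * (1 / 2 + k)|) := by
    by_cases hcase : 4 * δ ≤ (i m - j m) * scale N (m + 1)
    · refine ⟨z₀, ?_, Or.inl hcase⟩
      have : ε / 8 * δ ≤ ε / 2 * δ := by gcongr; norm_num
      rw [abs_le]
      constructor <;> linarith
    · push Not at hcase
      have hjm := hj1 m
      obtain ⟨z, h1, h2, h3⟩ := exists_int_far (n := N m) (R := 1 / 2 * T * j m) (by positivity)
        (by have := hr₀ m hmr₀; linarith) z₀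
      refine ⟨z, ?_, Or.inr h3⟩
      have h1' : (z₀ : ℝ) ≤ z := by exact_mod_cast h1
      have h4 : scale N (m + 1) * z₀ ≤ scale N (m + 1) * z := by gcongr
      have h5 : scale N (m + 1) * z ≤ scale N (m + 1) * (z₀ + (2 * (1 / 2 * T * j m) + 1)) := by
        gcongr
      have h6 : T * (j m * scale N (m + 1)) ≤ ε / 4 * δ := by
        have h7 : C * (j m * scale N (m + 1)) < 4 * δ := by
          refine lt_of_le_of_lt ?_ hcase
          rw [← mul_assoc]
          gcongr
          exact hr₁ m hmr₁
        have h8 : 16 * T / ε * (j m * scale N (m + 1)) ≤ C * (j m * scale N (m + 1)) := by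
          gcongr
          rw [hC]
          have : 0 < 32 / ε := by positivity
          linarith
        have h9 : T * (j m * scale N (m + 1))
            = ε / 16 * (16 * T / ε * (j m * scale N (m + 1))) := by field_simp
        rw [h9]
        calc ε / 16 * (16 * T / ε * (j m * scale N (m + 1))) ≤ ε / 16 * (4 * δ) := by
              exact mul_le_mul_of_nonneg_left (h8.trans h7.le) (by positivity)
          _ = ε / 4 * δ := by ring
      rw [abs_le]
      constructor <;> linarith
  -- the shift of the first end point
  obtain ⟨s, hsn, hsform⟩ : ∃ s : ℝ × ℝ, ‖s‖ ≤ ε / 2 * δ ∧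
      q * s.2 - p * s.1 = scale N (m + 1) * z - (q * A.2 - p * A.1) := by
    set w := scale N (m + 1) * z - (q * A.2 - p * A.1) with hw
    have hdiv : ∀ n : ℤ, n ≠ 0 → |w / n| ≤ |w| := by
      intro n hn
      rw [abs_div]
      refine div_le_self (abs_nonneg w) ?_
      exact_mod_cast Int.one_le_abs hn
    by_cases hq : q = 0
    · have hp : p ≠ 0 := by
        rintro rfl
        rw [hq] at hpq
        simp at hpq
      have hp' : (p : ℝ) ≠ 0 := by exact_mod_cast hp
      refine ⟨(-(w / p), 0), ?_, ?_⟩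
      · rw [Prod.norm_def, norm_zero, norm_neg, max_eq_left (norm_nonneg _)]
        exact (hdiv p hp).trans hzA
      · simp only
        field_simp
        ring
    · have hq' : (q : ℝ) ≠ 0 := by exact_mod_cast hq
      refine ⟨(0, w / q), ?_, ?_⟩
      · rw [Prod.norm_def, norm_zero, max_eq_right (norm_nonneg _)]
        exact (hdiv q hq).trans hzA
      · simp only
        field_simp
        ring
  have hεε₀ : ε * δ ≤ ε₀ * δ := by gcongr; exact min_le_left _ _
  set V : ℝ × ℝ := (lam * q, lam * p) with hV
  have hVn : ‖V - (B - A)‖ ≤ ε / 2 * δ := by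
    rw [norm_sub_rev, Prod.norm_def]
    exact max_le (hlq.trans hQδ) (hlp.trans hQδ)
  have hA' : ‖A + s - A‖ ≤ ε * δ := by
    rw [add_sub_cancel_left]
    have : 0 < ε * δ := by positivity
    linarith
  have hB' : ‖A + s + V - B‖ ≤ ε * δ := by
    have h1 : A + s + V - B = s + (V - (B - A)) := by abel
    rw [h1]
    refine (norm_add_le _ _).trans ?_
    linarith
  refine ⟨A + s, A + s + V, hA'.trans hεε₀, hB'.trans hεε₀, ?_⟩
  intro P hP
  have hPx : dist P x ≤ 2 * δ := by
    have hεδ : ε * δ ≤ 1 * δ := by gcongr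
    have h1 : A + s ∈ Metric.closedBall x (2 * δ) := by
      rw [mem_closedBall_iff_norm]
      have := norm_sub_le_norm_sub_add_norm_sub (A + s) A x
      linarith
    have h2 : A + s + V ∈ Metric.closedBall x (2 * δ) := by
      rw [mem_closedBall_iff_norm]
      have := norm_sub_le_norm_sub_add_norm_sub (A + s + V) B x
      linarith
    exact (convex_closedBall x (2 * δ)).segment_subset h1 h2 hP
  have hPform : q * P.2 - p * P.1 = scale N (m + 1) * z := by
    rw [segment_eq_image'] at hP
    obtain ⟨θ, -, rfl⟩ := hP
    simp only [add_sub_cancel_left, hV, Prod.fst_add, Prod.snd_add, Prod.smul_mk, smul_eq_mul]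
    linear_combination hsform
  -- squares of `planarSet N i` that are much larger than those of `planarSet N j` keep `P` away
  have hfar : ∀ (r : ℕ) (a b : ℤ), 4 * δ ≤ (i r - j r) * scale N (r + 1) →
      1 / 2 * j r * scale N (r + 1) ≤ dist P (scale N r * (1 / 2 + a), scale N r * (1 / 2 + b)) := by
    intro r a b h
    have h1 := mem_planarSet.1 hx r
    have h2 : ∀ a b : ℤ, 1 / 2 * i r * scale N (r + 1) ≤
        dist x P + dist P (scale N r * (1 / 2 + a), scale N r * (1 / 2 + b)) :=
      fun a b => (h1 a b).trans (dist_triangle _ _ _)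
    have h3 := h2 a b
    rw [dist_comm] at hPx
    linarith
  rw [mem_planarSet]
  intro r a b
  rcases lt_trichotomy r m with hr | rfl | hr
  · apply hfar
    rcases lt_or_ge r r₁ with h | h
    · exact hδc.trans (hcle r h)
    · have h1 := scale_antitone hN (by omega : r + 1 ≤ m)
      have h2 : C ≤ i r - j r := (le_mul_of_one_le_right hC0.le (hj1 r)).trans (hr₁ r h)
      have h3 : 32 / ε ≤ C := by
        have : 0 < 16 * T / ε := by positivity
        linarith
      calc 4 * δ = 32 / ε * (ε / 8 * δ) := by field_simp; ring
        _ ≤ (i r - j r) * scale N (r + 1) := by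
          refine mul_le_mul (h3.trans h2) (hm2.le.trans h1) (by positivity) ?_
          exact hC0.le.trans h2
  · rcases hzm with h | h
    · exact hfar r a b h
    · obtain ⟨k, hk⟩ := form_lattice hpq a b
      have h1 := abs_form_sub_le hpqT P (scale N r * (1 / 2 + a), scale N r * (1 / 2 + b))
      simp only [hPform, hk] at h1
      have h2 : scale N (r + 1) * z - scale N r * (1 / 2 + k)
          = scale N (r + 1) * (z - N r * (1 / 2 + k)) := by
        rw [scale_eq_mul hN r]; ring
      rw [h2, abs_mul, abs_of_pos hs] at h1
      have h3 : scale N (r + 1) * (1 / 2 * T * j r)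
          ≤ scale N (r + 1) * |(z : ℝ) - N r * (1 / 2 + k)| := by
        gcongr
        exact h k
      refine le_of_mul_le_mul_left ?_ hT0
      linarith
  · refine le_dist_of_form_eq hN hpq hpqT hT0 hr ?_ hPform a b
    have h1 := hr₀ r (by omega)
    have h2 := hj1 r
    have h3 : 0 ≤ T * j r := by positivity
    linarith

/-! ### Interpolating index sequences and cylinders -/

/-- The geometric interpolation between two index sequences, `k` for `u = 0` and `l` for `u = 1`. -/
noncomputable def interpolate (k l : ℕ → ℝ) (u : ℝ) : ℕ → ℝ :=
  fun r => k r * (l r / k r) ^ u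

theorem interpolate_zero (k l : ℕ → ℝ) : interpolate k l 0 = k := by
  ext r; simp [interpolate]

theorem interpolate_one {k l : ℕ → ℝ} (hk : ∀ r, 1 ≤ k r) : interpolate k l 1 = l := by
  ext r
  have := hk r
  simp only [interpolate, Real.rpow_one]
  field_simp

theorem interpolate_antitone {k l : ℕ → ℝ} (hl : ∀ r, 1 ≤ l r) (h : ∀ r, l r < k r) (r : ℕ) :
    StrictAnti fun u => interpolate k l u r := by
  intro u v huv
  have hl0 := hl r
  have hk0 : 0 < k r := by linarith [h r]
  exact mul_lt_mul_of_pos_left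
    (Real.rpow_lt_rpow_of_exponent_gt (by positivity) ((div_lt_one hk0).2 (h r)) huv) hk0

theorem continuous_interpolate {k l : ℕ → ℝ} (hl : ∀ r, 1 ≤ l r) (h : ∀ r, l r < k r) (r : ℕ) :
    Continuous fun u => interpolate k l u r := by
  have hl0 := hl r
  have hk0 : 0 < k r := by linarith [h r]
  exact continuous_const.mul (Real.continuous_const_rpow (by positivity))

/-- Interpolates with different parameters are comparable in the strict order: their ratio is a
positive power of `k r / l r`. -/
theorem prec_interpolate {k l : ℕ → ℝ} (hl : ∀ r, 1 ≤ l r) (h : Prec k l) {u v : ℝ}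
    (huv : u < v) : Prec (interpolate k l u) (interpolate k l v) := by
  refine ⟨fun r => interpolate_antitone hl h.1 r huv, ?_⟩
  have h1 := (tendsto_rpow_atTop (sub_pos.2 huv)).comp h.2
  refine h1.congr fun r => ?_
  have hl0 := hl r
  have hk0 : 0 < k r := by linarith [h.1 r]
  have hlk : 0 < l r / k r := by positivity
  simp only [Function.comp_apply, interpolate]
  rw [mul_div_mul_left _ _ hk0.ne', ← Real.rpow_sub hlk, ← inv_div, Real.inv_rpow hlk.le,
    ← Real.rpow_neg hlk.le, neg_sub]

/-- The projection of Euclidean space onto its first two coordinates. The target carries the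
supremum norm. -/
noncomputable def planeProj {n : ℕ} (hn : 2 ≤ n) : EuclideanSpace ℝ (Fin n) →L[ℝ] ℝ × ℝ :=
  (EuclideanSpace.proj (⟨0, by omega⟩ : Fin n)).prod (EuclideanSpace.proj (⟨1, by omega⟩ : Fin n))

theorem cylinderSet_eq_preimage {n : ℕ} (hn : 2 ≤ n) (N : ℕ → ℕ) (i : ℕ → ℝ) :
    cylinderSet hn N i = planeProj hn ⁻¹' planarSet N i := rfl

theorem planeProj_surjective {n : ℕ} (hn : 2 ≤ n) : Function.Surjective (planeProj hn) := by
  rintro ⟨a, b⟩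
  refine ⟨WithLp.toLp 2 fun i : Fin n => if i = ⟨0, by omega⟩ then a else b, ?_⟩
  simp [planeProj]

theorem isClosed_cylinderSet {n : ℕ} (hn : 2 ≤ n) (N : ℕ → ℕ) (i : ℕ → ℝ) :
    IsClosed (cylinderSet hn N i) :=
  (isClosed_planarSet N i).preimage (planeProj hn).continuous

/-- Approximability of segments passes to preimages under a continuous linear map with a
continuous linear right inverse. -/
theorem ApproximableAt.preimage {E F : Type*} [NormedAddCommGroup E] [NormedSpace ℝ E]
    [NormedAddCommGroup F] [NormedSpace ℝ F] {π : E →L[ℝ] F} {ι : F →L[ℝ] E}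
    (hι : ∀ y, π (ι y) = y) {M : Set F} {x : E} (h : ApproximableAt M (π x)) :
    ApproximableAt (π ⁻¹' M) x := by
  intro ε hε
  set C : ℝ := ‖π‖ + ‖ι‖ + 1 with hC
  have hC0 : 0 < C := by positivity
  have hπC : ∀ v, ‖π v‖ ≤ C * ‖v‖ := fun v => (π.le_opNorm v).trans <| by
    have := norm_nonneg ι
    gcongr; linarith
  have hιC : ∀ w, ‖ι w‖ ≤ C * ‖w‖ := fun w => (ι.le_opNorm w).trans <| by
    have := norm_nonneg π
    gcongr; linarith
  obtain ⟨δ₀, hδ₀, hδ⟩ := h (ε / C ^ 2) (by positivity)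
  refine ⟨δ₀ / C, by positivity, fun δ h0 h1 A B hA hB => ?_⟩
  have hbound : ∀ A : E, ‖A - x‖ ≤ δ → ‖π A - π x‖ ≤ C * δ := fun A hA => by
    rw [← map_sub]
    exact (hπC _).trans (by gcongr)
  obtain ⟨a, b, ha, hb, hab⟩ := hδ (C * δ) (by positivity)
    (by rw [lt_div_iff₀ hC0] at h1; linarith) (π A) (π B) (hbound A hA) (hbound B hB)
  have hlift : ∀ (A : E) (a : F), ‖a - π A‖ ≤ ε / C ^ 2 * (C * δ) →
      ‖A + ι (a - π A) - A‖ ≤ ε * δ := fun A a ha => by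
    rw [add_sub_cancel_left]
    calc ‖ι (a - π A)‖ ≤ C * (ε / C ^ 2 * (C * δ)) := (hιC _).trans (by gcongr)
      _ = ε * δ := by field_simp
  refine ⟨A + ι (a - π A), B + ι (b - π B), hlift A a ha, hlift B b hb, ?_⟩
  rintro P ⟨s, t, hs, ht, hst, rfl⟩
  refine hab ⟨s, t, hs, ht, hst, ?_⟩
  simp only [map_add, map_smul, hι, add_sub_cancel]

/-- The cylinders over the planar sets of the interpolated sequences form a chain of closed sets
to which the abstract differentiability criterion applies. -/
theorem exists_differentiableAt_mem_cylinderSet {n : ℕ} (hn : 2 ≤ n) {N : ℕ → ℕ}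
    (hN : ∀ r, 1 < N r) {k l : ℕ → ℝ} (hk : k ∈ indexSet N) (hl : l ∈ indexSet N)
    (hkl : Prec k l) {y : EuclideanSpace ℝ (Fin n)} (hy : y ∈ cylinderSet hn N k) {d : ℝ}
    (hd : 0 < d) {g : EuclideanSpace ℝ (Fin n) → ℝ} {K : ℝ≥0} (hg : LipschitzWith K g) :
    ∃ x ∈ cylinderSet hn N l ∩ Metric.closedBall y d, DifferentiableAt ℝ g x := by
  have hl1 : ∀ r, 1 ≤ l r := fun r => (hl.1 r).1
  have hk1 : ∀ r, 1 ≤ k r := fun r => (hk.1 r).1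
  have hanti := interpolate_antitone hl1 hkl.1
  obtain ⟨ι, hι⟩ := (planeProj hn).toLinearMap.exists_rightInverse_of_surjective
    (LinearMap.range_eq_top.2 (planeProj_surjective hn))
  have hι' : ∀ w, planeProj hn (LinearMap.toContinuousLinearMap ι w) = w := fun w =>
    LinearMap.congr_fun hι w
  have : Nontrivial (EuclideanSpace ℝ (Fin n)) := by
    have : Nonempty (Fin n) := ⟨⟨0, by omega⟩⟩
    infer_instance
  set M : ℝ → Set (EuclideanSpace ℝ (Fin n)) := fun u => cylinderSet hn N (interpolate k l u)
    with hM
  have hmono : ∀ u v, 0 ≤ u → u ≤ v → v ≤ 1 → M u ⊆ M v := by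
    intro u v _ huv _
    exact Set.preimage_mono (planarSet_anti hN fun r => (hanti r).antitone huv)
  have hinter : ∀ u, 0 ≤ u → u < 1 → ∀ z, (∀ v, u < v → v < 1 → z ∈ M v) → z ∈ M u := by
    intro u _ hu z hz
    have hz' : ∀ v, u < v → v < 1 → planeProj hn z ∈ planarSet N (interpolate k l v) := hz
    change planeProj hn z ∈ planarSet N (interpolate k l u)
    simp only [mem_planarSet] at hz' ⊢
    intro r a b
    have hc : Tendsto (fun v => 1 / 2 * interpolate k l v r * scale N (r + 1)) (𝓝[>] u)
        (𝓝 (1 / 2 * interpolate k l u r * scale N (r + 1))) :=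
      ((continuous_const.mul (continuous_interpolate hl1 hkl.1 r)).mul
        continuous_const).continuousWithinAt
    refine le_of_tendsto hc ?_
    filter_upwards [Ioo_mem_nhdsGT hu] with v hv
    exact hz' v hv.1 hv.2 r a b
  have happ : ∀ u v, 0 ≤ u → u < v → v < 1 → ∀ x ∈ M u, ApproximableAt (M v) x := by
    intro u v hu huv hv x hx
    have hv1 : ∀ r, 1 ≤ interpolate k l v r := fun r => by
      have := (hanti r).antitone hv.le
      simp only [interpolate_one hk1] at this
      exact (hl1 r).trans this
    refine ApproximableAt.preimage hι' (approximableAt_planarSet hN hv1 ?_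
      (prec_interpolate hl1 hkl huv) hx)
    refine squeeze_zero (fun r => ?_) (fun r => ?_) hk.2
    · have := hv1 r
      positivity
    · have := (hanti r).antitone (hu.trans huv.le)
      simp only [interpolate_zero] at this
      gcongr
  obtain ⟨x, hx, hxy, hgx⟩ := exists_differentiableAt_of_approximable
    (fun u => isClosed_cylinderSet hn N (interpolate k l u)) hmono hinter happ
    (y := y) (by simpa only [hM, interpolate_zero] using hy) hd hg
  refine ⟨x, ⟨?_, ?_⟩, hgx⟩
  · simpa only [interpolate_one hk1] using hx
  · rwa [mem_closedBall_iff_norm]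

/-! ### The cylinders have measure zero -/

open scoped Pointwise

theorem scale_succ_eq (N : ℕ → ℕ) (r : ℕ) :
    scale N (r + 1) = (N 0 : ℝ)⁻¹ * scale (fun s => N (s + 1)) r := by
  unfold scale
  rw [Finset.prod_range_succ', one_div, one_div, mul_inv, mul_comm]

theorem sub_int_mem_planarSet {N : ℕ → ℕ} (hN : ∀ r, 1 < N r) {i : ℕ → ℝ} {x : ℝ × ℝ}
    (hx : x ∈ planarSet N i) (a b : ℤ) : x - ((a : ℝ), (b : ℝ)) ∈ planarSet N i := by
  rw [mem_planarSet] at hx ⊢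
  intro r a' b'
  obtain ⟨k, hk⟩ := scale_eq_nat_mul hN (Nat.zero_le r)
  rw [scale_zero] at hk
  refine (hx r (a' + a * k) (b' + b * k)).trans_eq
    ((dist_sub_right _ _ ((a : ℝ), (b : ℝ))).symm.trans ?_)
  congr 1
  ext
  · simp only [Prod.fst_sub]
    push_cast
    linear_combination (-a : ℝ) * hk
  · simp only [Prod.snd_sub]
    push_cast
    linear_combination (-b : ℝ) * hk

/-- Magnification by the first term of `N` maps the planar set into the planar set of the shifted
sequences. -/
theorem smul_mem_planarSet_shift {N : ℕ → ℕ} (hN : ∀ r, 1 < N r) {i : ℕ → ℝ} {x : ℝ × ℝ}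
    (hx : x ∈ planarSet N i) :
    (N 0 : ℝ) • x ∈ planarSet (fun s => N (s + 1)) (fun s => i (s + 1)) := by
  rw [mem_planarSet] at hx ⊢
  intro r a b
  have hn : (0 : ℝ) < N 0 := by have := hN 0; positivity
  have h := hx (r + 1) a b
  rw [scale_succ_eq N (r + 1), scale_succ_eq N r] at h
  have h1 : ((scale (fun s => N (s + 1)) r * (1 / 2 + a),
      scale (fun s => N (s + 1)) r * (1 / 2 + b)) : ℝ × ℝ) = (N 0 : ℝ) •
      ((N 0 : ℝ)⁻¹ * scale (fun s => N (s + 1)) r * (1 / 2 + a),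
        (N 0 : ℝ)⁻¹ * scale (fun s => N (s + 1)) r * (1 / 2 + b)) := by
    ext <;> simp only [Prod.smul_mk, smul_eq_mul] <;> field_simp
  rw [h1, dist_smul₀, Real.norm_of_nonneg hn.le]
  calc _ = (N 0 : ℝ) * (1 / 2 * i (r + 1) * ((N 0 : ℝ)⁻¹ *
        scale (fun s => N (s + 1)) (r + 1))) := by field_simp
    _ ≤ _ := by gcongr

theorem volume_fst_eq (t : ℝ) : volume {x : ℝ × ℝ | x.1 = t} = 0 := by
  have : {x : ℝ × ℝ | x.1 = t} = {t} ×ˢ Set.univ := by ext; simp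
  rw [this, Measure.volume_eq_prod, Measure.prod_prod]
  simp

theorem volume_snd_eq (t : ℝ) : volume {x : ℝ × ℝ | x.2 = t} = 0 := by
  have : {x : ℝ × ℝ | x.2 = t} = Set.univ ×ˢ {t} := by ext; simp
  rw [this, Measure.volume_eq_prod, Measure.prod_prod]
  simp

/-- The part of the planar set with squares of minimal size in the half-open unit square. -/
def unitPart (N : ℕ → ℕ) : Set (ℝ × ℝ) :=
  planarSet N (fun _ => 1) ∩ Set.Ico 0 1 ×ˢ Set.Ico 0 1

/-- As `N 0` is odd, the removed square of the first level is, up to its boundary, the central one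
of the `N 0 ^ 2` cells of side `1 / N 0`. -/
theorem unitPart_subset {N : ℕ → ℕ} (hN : ∀ r, 1 < N r) {c : ℕ} (hc : N 0 = 2 * c + 1) :
    unitPart N ⊆ ({x | x.1 = c / N 0} ∪ {x | x.2 = c / N 0}) ∪
      ⋃ p ∈ (Finset.Ico (0 : ℤ) (N 0) ×ˢ Finset.Ico (0 : ℤ) (N 0)).erase (c, c),
        (N 0 : ℝ)⁻¹ • ((fun x : ℝ × ℝ => -((p.1 : ℝ), (p.2 : ℝ)) + x) ⁻¹'
          unitPart fun s => N (s + 1)) := by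
  rintro x ⟨hx, hx1, hx2⟩
  have hn : (0 : ℝ) < N 0 := by have := hN 0; positivity
  have hfloor : ∀ t : ℝ, t ∈ Set.Ico (0 : ℝ) 1 → ⌊(N 0 : ℝ) * t⌋ ∈ Finset.Ico (0 : ℤ) (N 0) := by
    intro t ht
    rw [Finset.mem_Ico, Int.floor_lt, Int.le_floor]
    have h0 := ht.1
    refine ⟨by push_cast; positivity, ?_⟩
    push_cast
    exact mul_lt_of_lt_one_right hn ht.2
  set a := ⌊(N 0 : ℝ) * x.1⌋ with ha
  set b := ⌊(N 0 : ℝ) * x.2⌋ with hb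
  have ha1 := Int.floor_le ((N 0 : ℝ) * x.1)
  have ha2 := Int.lt_floor_add_one ((N 0 : ℝ) * x.1)
  have hb1 := Int.floor_le ((N 0 : ℝ) * x.2)
  have hb2 := Int.lt_floor_add_one ((N 0 : ℝ) * x.2)
  rw [← ha] at ha1 ha2
  rw [← hb] at hb1 hb2
  by_cases hab : (a, b) = ((c : ℤ), (c : ℤ))
  · left
    obtain ⟨hac, hbc⟩ := Prod.ext_iff.1 hab
    simp only at hac hbc
    have hcN : (N 0 : ℝ) = 2 * c + 1 := by exact_mod_cast hc
    have h := mem_planarSet.1 hx 0 0 0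
    simp only [scale_succ_eq, scale_zero, Int.cast_zero, add_zero, mul_one, one_mul] at h
    rw [hac] at ha1 ha2
    rw [hbc] at hb1 hb2
    push_cast at ha1 ha2 hb1 hb2
    rw [Prod.dist_eq, le_max_iff, Real.dist_eq, Real.dist_eq] at h
    have key : ∀ t : ℝ, (c : ℝ) ≤ N 0 * t → N 0 * t < c + 1 →
        1 / 2 * (N 0 : ℝ)⁻¹ ≤ |t - 1 / 2| → t = c / N 0 := by
      intro t h1 h2 h3
      rw [eq_div_iff hn.ne']
      have h4 : 1 / 2 ≤ |(N 0 : ℝ) * t - N 0 / 2| := by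
        have h5 : (N 0 : ℝ) * t - N 0 / 2 = N 0 * (t - 1 / 2) := by ring
        rw [h5, abs_mul, abs_of_pos hn]
        calc (1 / 2 : ℝ) = N 0 * (1 / 2 * (N 0 : ℝ)⁻¹) := by field_simp
          _ ≤ _ := by gcongr
      rcases le_abs.1 h4 with h | h <;> linarith
    exact h.imp (key _ ha1 ha2) (key _ hb1 hb2)
  · right
    refine Set.mem_biUnion (x := (a, b)) (Finset.mem_coe.2 <| Finset.mem_erase.2
      ⟨hab, Finset.mem_product.2 ⟨hfloor _ hx1, hfloor _ hx2⟩⟩) ?_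
    rw [Set.mem_inv_smul_set_iff₀ hn.ne', Set.mem_preimage, neg_add_eq_sub]
    refine ⟨sub_int_mem_planarSet (fun r => hN (r + 1)) (smul_mem_planarSet_shift hN hx) a b,
      ⟨?_, ?_⟩, ?_, ?_⟩ <;> simp only [Prod.fst_sub, Prod.snd_sub, Prod.smul_fst, Prod.smul_snd,
        smul_eq_mul] <;> linarith

theorem volume_unitPart_le {N : ℕ → ℕ} (hodd : ∀ r, Odd (N r)) (hN : ∀ r, 1 < N r) :
    volume (unitPart N) ≤
      ENNReal.ofReal (1 - 1 / (N 0 : ℝ) ^ 2) * volume (unitPart fun s => N (s + 1)) := by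
  obtain ⟨c, hc⟩ := hodd 0
  have hn : (0 : ℝ) < N 0 := by have := hN 0; positivity
  refine (measure_mono (unitPart_subset hN hc)).trans ?_
  refine (measure_union_le _ _).trans ?_
  rw [measure_union_null (volume_fst_eq _) (volume_snd_eq _), zero_add]
  refine (measure_biUnion_finset_le _ _).trans ?_
  have hvol : ∀ p : ℤ × ℤ, volume ((N 0 : ℝ)⁻¹ • ((fun x : ℝ × ℝ => -((p.1 : ℝ), (p.2 : ℝ)) + x) ⁻¹'
      unitPart fun s => N (s + 1))) =
      ENNReal.ofReal (1 / (N 0 : ℝ) ^ 2) * volume (unitPart fun s => N (s + 1)) := by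
    intro p
    rw [Measure.addHaar_smul, measure_preimage_add]
    congr 2
    simp
  simp only [hvol]
  have hmem : ((c : ℤ), (c : ℤ)) ∈ Finset.Ico (0 : ℤ) (N 0) ×ˢ Finset.Ico (0 : ℤ) (N 0) := by
    simp only [Finset.mem_product, Finset.mem_Ico]
    omega
  rw [Finset.sum_const, Finset.card_erase_of_mem hmem, Finset.card_product, Int.card_Ico, sub_zero,
    Int.toNat_natCast, nsmul_eq_mul, ← mul_assoc, ← ENNReal.ofReal_natCast,
    ← ENNReal.ofReal_mul (Nat.cast_nonneg _)]
  gcongr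
  rw [Nat.cast_sub (Nat.mul_pos (by omega) (by omega))]
  push_cast
  apply le_of_eq
  field_simp

theorem volume_unitPart_le_prod (m : ℕ) {N : ℕ → ℕ} (hodd : ∀ r, Odd (N r)) (hN : ∀ r, 1 < N r) :
    volume (unitPart N) ≤ ENNReal.ofReal (∏ r ∈ Finset.range m, (1 - 1 / (N r : ℝ) ^ 2)) := by
  induction m generalizing N with
  | zero =>
    refine (measure_mono Set.inter_subset_right).trans ?_
    rw [Measure.volume_eq_prod, Measure.prod_prod]
    simp
  | succ m ih =>
    refine (volume_unitPart_le hodd hN).trans ?_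
    rw [Finset.prod_range_succ', mul_comm, ENNReal.ofReal_mul']
    · gcongr
      exact ih (fun r => hodd (r + 1)) fun r => hN (r + 1)
    · have : (1 : ℝ) ≤ N 0 := by exact_mod_cast (hN 0).le
      rw [sub_nonneg, div_le_one (by positivity)]
      nlinarith

/-- The bound by the partial products of `1 - 1 / N r ^ 2` tends to zero, because the sum of the
`1 / N r ^ 2` diverges. -/
theorem volume_unitPart {N : ℕ → ℕ} (hN : IsAdmissible N) : volume (unitPart N) = 0 := by
  have h1 : Tendsto (fun m => ∑ r ∈ Finset.range m, 1 / (N r : ℝ) ^ 2) atTop atTop :=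
    (not_summable_iff_tendsto_nat_atTop_of_nonneg fun r => by positivity).1 hN.not_summable
  have h2 : Tendsto (fun m => ENNReal.ofReal
      (Real.exp (-∑ r ∈ Finset.range m, 1 / (N r : ℝ) ^ 2))) atTop (𝓝 0) := by
    have := ENNReal.tendsto_ofReal (Real.tendsto_exp_neg_atTop_nhds_zero.comp h1)
    simpa using this
  refine le_antisymm (ge_of_tendsto' h2 fun m => ?_) zero_le
  refine (volume_unitPart_le_prod m hN.odd hN.one_lt).trans (ENNReal.ofReal_le_ofReal ?_)
  rw [← Finset.sum_neg_distrib, Real.exp_sum]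
  refine Finset.prod_le_prod (fun r _ => ?_) fun r _ => ?_
  · have : (1 : ℝ) ≤ N r := by exact_mod_cast (hN.one_lt r).le
    rw [sub_nonneg, div_le_one (by positivity)]
    nlinarith
  · linarith [Real.add_one_le_exp (-(1 / (N r : ℝ) ^ 2))]

theorem volume_planarSet {N : ℕ → ℕ} (hN : IsAdmissible N) {i : ℕ → ℝ} (hi : ∀ r, 1 ≤ i r) :
    volume (planarSet N i) = 0 := by
  refine measure_mono_null (planarSet_anti hN.one_lt hi) ?_
  have hsub : planarSet N (fun _ => 1) ⊆ ⋃ p : ℤ × ℤ,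
      (fun x : ℝ × ℝ => -((p.1 : ℝ), (p.2 : ℝ)) + x) ⁻¹' unitPart N := by
    intro x hx
    refine Set.mem_iUnion.2 ⟨(⌊x.1⌋, ⌊x.2⌋), ?_⟩
    rw [Set.mem_preimage, neg_add_eq_sub]
    exact ⟨sub_int_mem_planarSet hN.one_lt hx _ _,
      ⟨Int.fract_nonneg _, Int.fract_lt_one _⟩, ⟨Int.fract_nonneg _, Int.fract_lt_one _⟩⟩
  refine measure_mono_null hsub (measure_iUnion_null fun p => ?_)
  rw [measure_preimage_add, volume_unitPart hN]

theorem volume_cylinderSet {n : ℕ} (hn : 2 ≤ n) {N : ℕ → ℕ} (hN : IsAdmissible N) {i : ℕ → ℝ}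
    (hi : ∀ r, 1 ≤ i r) : volume (cylinderSet hn N i) = 0 := by
  have h := (ae_comp_linearMap_mem_iff (planeProj hn).toLinearMap volume volume
    (planeProj_surjective hn) (isClosed_planarSet N i).isOpen_compl.measurableSet).2
    (measure_eq_zero_iff_ae_notMem.1 (volume_planarSet hN hi))
  exact measure_eq_zero_iff_ae_notMem.2 h

/-! ### Admissible sequences and index sequences -/

theorem exists_isAdmissible : ∃ N : ℕ → ℕ, IsAdmissible N := by
  refine ⟨fun r => 2 * Nat.sqrt r + 3, fun r => ⟨Nat.sqrt r + 1, by ring⟩, fun r => by omega,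
    tendsto_atTop_atTop.2 fun b => ⟨b * b, fun r hr => ?_⟩, fun h => ?_⟩
  · have := Nat.le_sqrt.2 hr
    omega
  · refine Real.not_summable_one_div_natCast ?_
    rw [← summable_nat_add_iff 1]
    refine Summable.of_nonneg_of_le (fun r => by positivity) (fun r => ?_) (h.mul_left 16)
    have h1 : (2 * Nat.sqrt r + 3) ^ 2 ≤ 16 * (r + 1) := by
      have := Nat.sqrt_le r
      nlinarith [Nat.le_mul_self (Nat.sqrt r)]
    have h2 : ((2 * Nat.sqrt r + 3 : ℕ) : ℝ) ^ 2 ≤ 16 * ((r + 1 : ℕ) : ℝ) := by exact_mod_cast h1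
    rw [mul_one_div, div_le_div_iff₀ (by positivity) (by positivity)]
    linarith

theorem one_mem_indexSet {N : ℕ → ℕ} (hN : IsAdmissible N) : (fun _ => 1) ∈ indexSet N := by
  refine ⟨fun r => ⟨le_rfl, Nat.one_lt_cast.2 (hN.one_lt r)⟩, ?_⟩
  exact (tendsto_const_nhds.div_atTop (tendsto_natCast_atTop_atTop.comp hN.tendsto))

/-- Below an index sequence `l` in the order `≺` there is the geometric mean of `l` and `N`. -/
theorem exists_prec {N : ℕ → ℕ} {l : ℕ → ℝ} (hl : l ∈ indexSet N) :
    ∃ k ∈ indexSet N, Prec k l := by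
  have hl0 : ∀ r, 0 < l r := fun r => zero_lt_one.trans_le (hl.1 r).1
  have hN0 : ∀ r, (0 : ℝ) < N r := fun r => (hl0 r).trans (hl.1 r).2
  have hlk : ∀ r, l r < √(l r * N r) := fun r => by
    have h1 := hl0 r
    rw [Real.lt_sqrt h1.le, sq]
    exact mul_lt_mul_of_pos_left (hl.1 r).2 h1
  refine ⟨fun r => √(l r * N r), ⟨fun r => ⟨(hl.1 r).1.trans (hlk r).le, ?_⟩, ?_⟩, hlk, ?_⟩
  · rw [Real.sqrt_lt' (hN0 r), sq]
    exact mul_lt_mul_of_pos_right (hl.1 r).2 (hN0 r)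
  · have h1 : Tendsto (fun r => √(l r / N r)) atTop (𝓝 √0) := hl.2.sqrt
    rw [Real.sqrt_zero] at h1
    refine h1.congr fun r => ?_
    have h2 := hN0 r
    have h3 : l r / N r = l r * N r / (N r : ℝ) ^ 2 := by field_simp
    simp only
    rw [h3, Real.sqrt_div' _ (sq_nonneg _), Real.sqrt_sq h2.le]
  · have h1 : Tendsto (fun r => (√(l r / N r))⁻¹) atTop atTop := by
      refine tendsto_inv_nhdsGT_zero.comp (tendsto_nhdsWithin_iff.2 ⟨?_, ?_⟩)
      · simpa using hl.2.sqrt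
      · exact Eventually.of_forall fun r => Real.sqrt_pos.2 (div_pos (hl0 r) (hN0 r))
    refine h1.congr fun r => ?_
    have h2 := hl0 r
    have h3 := hN0 r
    have h4 : (l r / N r)⁻¹ = l r * N r / (l r) ^ 2 := by field_simp
    simp only
    rw [← Real.sqrt_inv, h4, Real.sqrt_div' _ (sq_nonneg _), Real.sqrt_sq h2.le]

theorem zero_mem_cylinderSet {n : ℕ} (hn : 2 ≤ n) {N : ℕ → ℕ} (hN : ∀ r, 1 < N r) {i : ℕ → ℝ}
    (hi : ∀ r, i r ≤ N r) : 0 ∈ cylinderSet hn N i := by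
  rw [cylinderSet_eq_preimage, Set.mem_preimage, map_zero, mem_planarSet]
  intro r a b
  have hs := scale_pos hN (r + 1)
  have hs' := scale_pos hN r
  have h1 : (1 / 2 : ℝ) ≤ |1 / 2 + (a : ℝ)| := by
    rcases le_or_gt 0 a with h | h
    · have : (0 : ℝ) ≤ a := by exact_mod_cast h
      exact (by linarith : (1 / 2 : ℝ) ≤ 1 / 2 + a).trans (le_abs_self _)
    · have : (a : ℝ) ≤ -1 := by exact_mod_cast (by omega : a ≤ -1)
      exact (by linarith : (1 / 2 : ℝ) ≤ -(1 / 2 + a)).trans (neg_le_abs _)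
  rw [dist_zero_left]
  refine le_trans ?_ (norm_fst_le _)
  rw [Real.norm_eq_abs, abs_mul, abs_of_pos hs']
  calc 1 / 2 * i r * scale N (r + 1) ≤ 1 / 2 * N r * scale N (r + 1) := by
        have := hi r
        gcongr
    _ = scale N r * (1 / 2) := by rw [scale_eq_mul hN r]; ring
    _ ≤ _ := by gcongr

end DifferentiabilitySet

theorem mainTheorem1 (n : ℕ) (hn : 2 ≤ n) :
    (∃ S : Set (EuclideanSpace ℝ (Fin n)),
      IsCompact S ∧ volume S = 0 ∧ DifferentiabilitySet.CapturesDifferentiability S) ∧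
    (∃ N : ℕ → ℕ, DifferentiabilitySet.IsAdmissible N) ∧
    ∀ N : ℕ → ℕ, DifferentiabilitySet.IsAdmissible N →
      (DifferentiabilitySet.indexSet N).Nonempty ∧
      ∀ l ∈ DifferentiabilitySet.indexSet N,
        (∃ k ∈ DifferentiabilitySet.indexSet N, DifferentiabilitySet.Prec k l) ∧
        ∀ k ∈ DifferentiabilitySet.indexSet N, DifferentiabilitySet.Prec k l →
          (DifferentiabilitySet.cylinderSet hn N k).Nonempty ∧
          ∀ y ∈ DifferentiabilitySet.cylinderSet hn N k, ∀ d : ℝ, 0 < d →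
            IsCompact (DifferentiabilitySet.cylinderSet hn N l ∩ Metric.closedBall y d) ∧
            volume (DifferentiabilitySet.cylinderSet hn N l ∩ Metric.closedBall y d) = 0 ∧
            DifferentiabilitySet.CapturesDifferentiability
              (DifferentiabilitySet.cylinderSet hn N l ∩ Metric.closedBall y d) := by
  have hcyl : ∀ N : ℕ → ℕ, DifferentiabilitySet.IsAdmissible N →
      ∀ l ∈ DifferentiabilitySet.indexSet N, ∀ k ∈ DifferentiabilitySet.indexSet N,
      DifferentiabilitySet.Prec k l →
      ∀ y ∈ DifferentiabilitySet.cylinderSet hn N k, ∀ d : ℝ, 0 < d →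
        IsCompact (DifferentiabilitySet.cylinderSet hn N l ∩ Metric.closedBall y d) ∧
        volume (DifferentiabilitySet.cylinderSet hn N l ∩ Metric.closedBall y d) = 0 ∧
        DifferentiabilitySet.CapturesDifferentiability
          (DifferentiabilitySet.cylinderSet hn N l ∩ Metric.closedBall y d) := by
    intro N hN l hl k hk hkl y hy d hd
    refine ⟨(isCompact_closedBall y d).inter_left
      (DifferentiabilitySet.isClosed_cylinderSet hn N l), ?_, ?_⟩
    · exact measure_mono_null Set.inter_subset_left
        (DifferentiabilitySet.volume_cylinderSet hn hN fun r => (hl.1 r).1)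
    · rintro g ⟨K, hg⟩
      exact DifferentiabilitySet.exists_differentiableAt_mem_cylinderSet hn hN.one_lt hk hl hkl
        hy hd hg
  have hzero : ∀ N : ℕ → ℕ, DifferentiabilitySet.IsAdmissible N →
      ∀ k ∈ DifferentiabilitySet.indexSet N, 0 ∈ DifferentiabilitySet.cylinderSet hn N k :=
    fun N hN k hk =>
      DifferentiabilitySet.zero_mem_cylinderSet hn hN.one_lt fun r => (hk.1 r).2.le
  refine ⟨?_, DifferentiabilitySet.exists_isAdmissible, fun N hN =>
    ⟨⟨_, DifferentiabilitySet.one_mem_indexSet hN⟩, fun l hl =>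
      ⟨DifferentiabilitySet.exists_prec hl, fun k hk hkl =>
        ⟨⟨0, hzero N hN k hk⟩, hcyl N hN l hl k hk hkl⟩⟩⟩⟩
  obtain ⟨N, hN⟩ := DifferentiabilitySet.exists_isAdmissible
  have hl := DifferentiabilitySet.one_mem_indexSet hN
  obtain ⟨k, hk, hkl⟩ := DifferentiabilitySet.exists_prec hl
  exact ⟨_, hcyl N hN _ hl k hk hkl 0 (hzero N hN k hk) 1 one_pos⟩
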